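/- Let $H$ be a (real or complex) separable Hilbert space and $A$ a self-adjoint, positive, unbounded operator in $H$ with domain $D(A)$, having a complete orthonormal system of eigenvectors $\{v_k\}_{k\ge1}$ with eigenvalues $0<\lambda_1\le\lambda_2\le\cdots\to+\infty$. Write $h_k=(h,v_k)$, and for $\tau\in\mathbb R$ let $D(A^\tau)=\{h\in H:\ \|h\|_\tau^2:=\sum_k\lambda_k^{2\tau}|h_k|^2<\infty\}$. Let $\rho\in(0,1)$, $\gamma>0$, $T>0$. The Caputo derivative is $$D_t^\rho h(t)=\frac1{\Gamma(1-\rho)}\int_0^t\frac{h'(\xi)}{(t-\xi)^\rho}\,d\xi ,$$ provided that $h$ is differentiable on $(0,t)$ and the (Bochner) integral exists. For $\lambda>0$, $t\ge0$ put $$A_\rho(\lambda,t)=\frac\gamma\pi\int_0^\infty e^{-rt}\frac{\lambda^2r^{\rho-1}\sin\rho\pi}{(-r+\lambda\gamma r^\rho\cos\rho\pi+\lambda)^2+(\lambda\gamma r^\rho\sin\rho\pi)^2}\,dr,$$ $$B_\rho(\lambda,t)=\frac\gamma\pi\int_0^\infty e^{-rt}\frac{\lambda r^{\rho}\sin\rho\pi}{(-r+\lambda\gamma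 r^\rho\cos\rho\pi+\lambda)^2+(\lambda\gamma r^\rho\sin\rho\pi)^2}\,dr.$$ A function $u\in C([0,T];H)$ is called a solution of the forward problem $$D_tu(t)+A(1+\gamma D_t^\rho)u(t)=f(t)\quad(0<t\le T),\qquad u(0)=\phi, \qquad (1)$$ if $D_tu$, $Au$ and $AD_t^\rho u$ exist on $(0,T]$ and belong to $C((0,T];H)$, and $u$ satisfies (1) (the derivative at $t=T$ is one-sided). Theorem. For every $\varepsilon\in(0,1)$, every $f\in C([0,T];D(A^\varepsilon))$ (continuity in the norm $\|\cdot\|_\varepsilon$) and every $\phi\in D(A)$, problem (1) has a unique solution $u$ on $[0,T]$, and it has the form $$u(t)=\sum_{k=1}^\infty A_\rho(\lambda_k,t)\phi_kv_k+\sum_{k=1}^\infty\Big[\int_0^tB_\rho(\lambda_k,t-\tau)f_k(\tau)\,d\tau\Big]v_k,\qquad 0\le t\le T,$$ both series converging in $H$. Moreover there are a constant $C>0$, independent of $\varepsilon,f,\phi,t$, and for each $\varepsilon$ a constant $C_\varepsilon>0$, independent of $f,\phi,t$, such that $$\|D_tu(t)\|^2+\|Au(t)\|^2+\|AD_t^\rho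 u(t)\|^2\le C\,t^{2(\rho-1)}\|\phi\|^2+C\,\|\phi\|_1^2+C_\varepsilon\max_{s\in[0,T]}\|f(s)\|_\varepsilon^2,\qquad 0<t\le T.$$ -/

import Mathlib

open Set Filter Topology MeasureTheory

noncomputable section

namespace RayleighStokes

/-- Common denominator of the integrands of `A_ρ(lam, t)` and `B_ρ(lam, t)`. -/
def kernelDenom (ρ γ lam r : ℝ) : ℝ :=
  (-r + lam * γ * r ^ ρ * Real.cos (ρ * Real.pi) + lam) ^ 2
    + (lam * γ * r ^ ρ * Real.sin (ρ * Real.pi)) ^ 2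

/-- The function `A_ρ(lam, t)`. -/
def kernelA (ρ γ lam t : ℝ) : ℝ :=
  γ / Real.pi * ∫ r in Ioi (0 : ℝ), Real.exp (-r * t) *
    (lam ^ 2 * r ^ (ρ - 1) * Real.sin (ρ * Real.pi) / kernelDenom ρ γ lam r)

/-- The function `B_ρ(lam, t)`. -/
def kernelB (ρ γ lam t : ℝ) : ℝ :=
  γ / Real.pi * ∫ r in Ioi (0 : ℝ), Real.exp (-r * t) *
    (lam * r ^ ρ * Real.sin (ρ * Real.pi) / kernelDenom ρ γ lam r)

section Caputo

variable {H : Type*} [NormedAddCommGroup H] [NormedSpace ℝ H]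

/-- The Caputo derivative of order `ρ` of `h` exists at `t`: `h` is differentiable on `(0, t)`
and the integral defining the Caputo derivative converges (as a Bochner integral). -/
def CaputoExists (ρ : ℝ) (h : ℝ → H) (t : ℝ) : Prop :=
  (∀ ξ ∈ Ioo (0 : ℝ) t, DifferentiableAt ℝ h ξ) ∧
    IntegrableOn (fun ξ => (t - ξ) ^ (-ρ) • deriv h ξ) (Ioo 0 t)

/-- The Caputo derivative of order `ρ`,
`(1 / Γ(1 - ρ)) ∫_0^t h'(ξ) (t - ξ)^(-ρ) dξ`; meaningful when `CaputoExists ρ h t`. -/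
def caputo (ρ : ℝ) (h : ℝ → H) (t : ℝ) : H :=
  (1 / Real.Gamma (1 - ρ)) • ∫ ξ in Ioo (0 : ℝ) t, (t - ξ) ^ (-ρ) • deriv h ξ

end Caputo

section Operator

variable {𝕜 : Type*} [RCLike 𝕜] {H : Type*} [NormedAddCommGroup H] [InnerProductSpace 𝕜 H]

/-- The value `A x` for `x` in the domain of the unbounded operator `A` (and `0` elsewhere;
it is used only together with membership in the domain). -/
def app (A : H →ₗ.[𝕜] H) (x : H) : H :=
  open Classical in if hx : x ∈ A.domain then A ⟨x, hx⟩ else 0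

/-- `A` is self-adjoint, and `v` is a complete orthonormal system of eigenvectors of `A` with
positive eigenvalues `lam 0 ≤ lam 1 ≤ ⋯ → +∞`. (Positivity and unboundedness of `A` follow.) -/
structure IsEigenSystem (A : H →ₗ.[𝕜] H) [CompleteSpace H] (v : HilbertBasis ℕ 𝕜 H)
    (lam : ℕ → ℝ) : Prop where
  selfAdjoint : IsSelfAdjoint A
  eigen : ∀ k, ∃ hk : v k ∈ A.domain, A ⟨v k, hk⟩ = (lam k : 𝕜) • v k
  pos : ∀ k, 0 < lam k
  mono : Monotone lam
  unbounded : Tendsto lam atTop atTop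

/-- The domain `D(A^τ)` of the fractional power `A^τ`. -/
def fracDomain (v : HilbertBasis ℕ 𝕜 H) (lam : ℕ → ℝ) (τ : ℝ) : Set H :=
  {h | Summable fun k => lam k ^ (2 * τ) * ‖inner 𝕜 (v k) h‖ ^ 2}

/-- The norm `‖h‖_τ = ‖A^τ h‖` on `D(A^τ)`. -/
def fracNorm (v : HilbertBasis ℕ 𝕜 H) (lam : ℕ → ℝ) (τ : ℝ) (h : H) : ℝ :=
  Real.sqrt (∑' k, lam k ^ (2 * τ) * ‖inner 𝕜 (v k) h‖ ^ 2)

/-- `f ∈ C([0, T]; D(A^τ))`, the continuity being with respect to the norm `‖·‖_τ`. -/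
def ContinuousInFracDomain (v : HilbertBasis ℕ 𝕜 H) (lam : ℕ → ℝ) (τ T : ℝ)
    (f : ℝ → H) : Prop :=
  (∀ t ∈ Icc 0 T, f t ∈ fracDomain v lam τ) ∧
    ∀ t₀ ∈ Icc 0 T,
      Tendsto (fun t => fracNorm v lam τ (f t - f t₀)) (𝓝[Icc 0 T] t₀) (𝓝 0)

variable [NormedSpace ℝ H]

/-- `u` is a solution on `[0, T]` of the forward problem
`u' + A (1 + γ D^ρ) u = f` on `(0, T]`, `u(0) = φ`. The derivative of `u` is one-sided at `T`. -/
structure IsForwardSolution (A : H →ₗ.[𝕜] H) (ρ γ T : ℝ) (f : ℝ → H) (φ : H)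
    (u : ℝ → H) : Prop where
  cont : ContinuousOn u (Icc 0 T)
  diff : ∀ t ∈ Ioc 0 T, DifferentiableWithinAt ℝ u (Icc 0 T) t
  cont_deriv : ContinuousOn (derivWithin u (Icc 0 T)) (Ioc 0 T)
  mem_domain : ∀ t ∈ Ioc 0 T, u t ∈ A.domain
  cont_app : ContinuousOn (fun t => app A (u t)) (Ioc 0 T)
  caputo_exists : ∀ t ∈ Ioc 0 T, CaputoExists ρ u t
  caputo_mem_domain : ∀ t ∈ Ioc 0 T, caputo ρ u t ∈ A.domain
  cont_app_caputo : ContinuousOn (fun t => app A (caputo ρ u t)) (Ioc 0 T)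
  equation : ∀ t ∈ Ioc 0 T,
    derivWithin u (Icc 0 T) t + app A (u t + γ • caputo ρ u t) = f t
  initial : u 0 = φ

end Operator

end RayleighStokes

end

open Set Filter Topology MeasureTheory

noncomputable section

namespace RayleighStokes

/-! In the coordinates of the eigenbasis the problem is diagonal. For an eigenvalue `lam`, the
derivative `p` of a coordinate of the solution solves the Volterra equation `p + K * p = f - lam φ`,
where `K` is `volterraKernel` and `*` is convolution on `[0, t]`. Everything rests on the resolvent
of `K`, which is `D = kernelD`, formally the negative derivative of `kernelB`: `D + K * D = K`
almost everywhere (`kernelD_resolvent`). Hence `p = c - D * c` with `c = f - lam φ`, and integration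
gives the coordinate `A_ρ φ + B_ρ * f` of the solution.

The resolvent identity is checked on Laplace transforms, which requires the transform of `kernelB`
to be `symbol`, that is `1 / (s + lam + lam γ s^ρ)`. Since `kernelB` is the Laplace transform of the
nonnegative `spectralDensity`, this is a Stieltjes representation, obtained from Cauchy's theorem in
the variable `w = log z`, in which the cut plane becomes the strip `|Im w| ≤ π`
(`tendsto_stieltjes_exp`, `stieltjes`). Letting `s` tend to infinity and to zero yields the two
moments of the density, hence all bounds on the kernels.

For existence, `f` is written as `A^(-ε) Φ` with `Φ` continuous. The multipliers `lam^(-ε) D` and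
`lam^(1-ε) B` are bounded, uniformly in `lam`, by powers of `s` integrable at 0, through
interpolation between two elementary bounds. Thus the derivative and `A u` are given by convergent
operator-valued convolutions that are continuous up to `t = 0`; as `φ` lies in the domain of `A`,
the bounds involve only `‖A φ‖` and `f`, and the singular term in the final estimate is not needed.

For uniqueness, each coordinate of the difference of two solutions satisfies `y + K * y = 0`, and
the resolvent forces `y = 0`. -/

theorem integrableOn_of_continuousOn_Icc {E : Type*} [NormedAddCommGroup E] {c : ℝ → E} {T : ℝ} (hc : ContinuousOn c (Icc 0 T)) :
    IntegrableOn c (Ioo 0 T) :=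
  (hc.integrableOn_compact isCompact_Icc).mono_set Ioo_subset_Icc_self

/-! ### Algebra of convolution on the half-line. -/

section CausalConvolution

variable {E : Type*} [NormedAddCommGroup E] [NormedSpace ℝ E]

/-- The convolution of two functions on the half-line. -/
def causalConv (a : ℝ → ℝ) (f : ℝ → E) (t : ℝ) : E := ∫ s in (0 : ℝ)..t, a s • f (t - s)

/-- Extension by zero outside `(0, T)` makes the integrand vanish unless `0 < s < t`. This transfers
integrability and associativity from convolution on the whole line. -/
theorem causalConv_eq_convolution (a : ℝ → ℝ) (f : ℝ → E) {t T : ℝ} (ht : t ∈ Icc 0 T) :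
    causalConv a f t = convolution ((Ioo 0 T).indicator a) ((Ioo 0 T).indicator f)
      (ContinuousLinearMap.lsmul ℝ ℝ) volume t := by
  rw [causalConv, intervalIntegral.integral_of_le ht.1, integral_Ioc_eq_integral_Ioo,
    ← integral_indicator measurableSet_Ioo, convolution]
  congr 1 with s
  by_cases hs : s ∈ Ioo 0 t
  · have h1 : s ∈ Ioo 0 T := ⟨hs.1, hs.2.trans_le ht.2⟩
    have h2 : t - s ∈ Ioo 0 T := ⟨sub_pos.2 hs.2, by linarith [hs.1, ht.2]⟩
    simp [indicator_of_mem hs, indicator_of_mem h1, indicator_of_mem h2]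
  · rw [indicator_of_notMem hs]
    by_cases h1 : s ∈ Ioo 0 T
    · have h2 : t - s ∉ Ioo 0 T := fun h => hs ⟨h1.1, sub_pos.1 h.1⟩
      simp [indicator_of_notMem h2]
    · simp [indicator_of_notMem h1]

theorem intervalIntegrable_causalConv {a : ℝ → ℝ} {c : ℝ → E} {t T : ℝ}
    (ha : IntegrableOn a (Ioo 0 T)) (hc : ContinuousOn c (Icc 0 T)) (ht : t ∈ Icc 0 T) :
    IntervalIntegrable (fun s => a s • c (t - s)) volume 0 t := by
  rw [intervalIntegrable_iff_integrableOn_Ioo_of_le ht.1]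
  have hc' : ContinuousOn (fun s => c (t - s)) (Icc 0 t) :=
    hc.comp (by fun_prop) fun s hs => ⟨by linarith [hs.2], by linarith [hs.1, ht.2]⟩
  obtain ⟨M, hM⟩ := isCompact_Icc.exists_bound_of_continuousOn hc'
  have ha' : IntegrableOn a (Ioo 0 t) := ha.mono_set (Ioo_subset_Ioo_right ht.2)
  refine Integrable.smul_bdd ha' M ?_ ?_
  · exact (hc'.mono Ioo_subset_Icc_self).aestronglyMeasurable measurableSet_Ioo
  · exact (ae_restrict_mem measurableSet_Ioo).mono fun s hs => hM s (Ioo_subset_Icc_self hs)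

theorem causalConv_sub {a : ℝ → ℝ} {c d : ℝ → E} {t T : ℝ}
    (ha : IntegrableOn a (Ioo 0 T)) (hc : ContinuousOn c (Icc 0 T))
    (hd : ContinuousOn d (Icc 0 T)) (ht : t ∈ Icc 0 T) :
    causalConv a (fun s => c s - d s) t = causalConv a c t - causalConv a d t := by
  simp only [causalConv, smul_sub]
  exact intervalIntegral.integral_sub (intervalIntegrable_causalConv ha hc ht)
    (intervalIntegrable_causalConv ha hd ht)

theorem causalConv_sub_left {a b : ℝ → ℝ} {c : ℝ → E} {t T : ℝ}
    (ha : IntegrableOn a (Ioo 0 T)) (hb : IntegrableOn b (Ioo 0 T))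
    (hc : ContinuousOn c (Icc 0 T)) (ht : t ∈ Icc 0 T) :
    causalConv (fun s => a s - b s) c t = causalConv a c t - causalConv b c t := by
  simp only [causalConv, sub_smul]
  exact intervalIntegral.integral_sub (intervalIntegrable_causalConv ha hc ht)
    (intervalIntegrable_causalConv hb hc ht)

theorem causalConv_congr {a : ℝ → ℝ} {c d : ℝ → E} {t T : ℝ}
    (h : ∀ s ∈ Icc 0 T, c s = d s) (ht : t ∈ Icc 0 T) : causalConv a c t = causalConv a d t := by
  refine intervalIntegral.integral_congr fun s hs => ?_
  rw [uIcc_of_le ht.1] at hs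
  simp only [h (t - s) ⟨by linarith [hs.2], by linarith [hs.1, ht.2]⟩]

theorem causalConv_congr_left {a b : ℝ → ℝ} {c : ℝ → E} {t T : ℝ}
    (h : ∀ᵐ s ∂volume.restrict (Ioo 0 T), a s = b s) (ht : t ∈ Icc 0 T) :
    causalConv a c t = causalConv b c t := by
  simp only [causalConv, intervalIntegral.integral_of_le ht.1, integral_Ioc_eq_integral_Ioo]
  refine integral_congr_ae ?_
  filter_upwards [ae_restrict_of_ae_restrict_of_subset (Ioo_subset_Ioo_right ht.2) h] with s hs
  rw [hs]

theorem causalConv_comm (a b : ℝ → ℝ) (t : ℝ) : causalConv a b t = causalConv b a t := by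
  have := intervalIntegral.integral_comp_sub_left (a := 0) (b := t) (fun s => b s * a (t - s)) t
  simp only [sub_sub_cancel, sub_zero, sub_self] at this
  simp only [causalConv, smul_eq_mul, ← this, mul_comm]

theorem integrableOn_causalConv {a : ℝ → ℝ} {b : ℝ → E} {T : ℝ}
    (ha : IntegrableOn a (Ioo 0 T)) (hb : IntegrableOn b (Ioo 0 T)) :
    IntegrableOn (causalConv a b) (Ioo 0 T) := by
  have h := (((integrable_indicator_iff measurableSet_Ioo).2 ha).integrable_convolution
    (ContinuousLinearMap.lsmul ℝ ℝ) ((integrable_indicator_iff measurableSet_Ioo).2 hb))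
  refine h.integrableOn.congr_fun (fun t ht => ?_) measurableSet_Ioo
  exact (causalConv_eq_convolution a b (Ioo_subset_Icc_self ht)).symm

/-- Fubini, applied to the extensions by zero. Boundedness of `c` makes the triple integral converge
absolutely at every `t`, so the identity holds everywhere and not merely almost everywhere. -/
theorem causalConv_assoc [CompleteSpace E] {a b : ℝ → ℝ} {c : ℝ → E} {t T : ℝ}
    (ha : IntegrableOn a (Ioo 0 T)) (hb : IntegrableOn b (Ioo 0 T))
    (hc : ContinuousOn c (Icc 0 T)) (ht : t ∈ Icc 0 T) :
    causalConv (causalConv a b) c t = causalConv a (causalConv b c) t := by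
  set a' := (Ioo 0 T).indicator a with ha'
  set b' := (Ioo 0 T).indicator b with hb'
  set c' := (Ioo 0 T).indicator c with hc'
  have ia : Integrable a' := (integrable_indicator_iff measurableSet_Ioo).2 ha
  have ib : Integrable b' := (integrable_indicator_iff measurableSet_Ioo).2 hb
  have ic : Integrable c' :=
    (integrable_indicator_iff measurableSet_Ioo).2 (integrableOn_of_continuousOn_Icc hc)
  obtain ⟨M, hM⟩ := isCompact_Icc.exists_bound_of_continuousOn hc
  have hM0 : 0 ≤ M := (norm_nonneg _).trans (hM t ht)
  have hcM : ∀ s, ‖c' s‖ ≤ M := fun s => by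
    by_cases hs : s ∈ Ioo 0 T
    · rw [hc', indicator_of_mem hs]; exact hM s (Ioo_subset_Icc_self hs)
    · rw [hc', indicator_of_notMem hs]; simpa using hM0
  have key : convolution (convolution a' b' (ContinuousLinearMap.lsmul ℝ ℝ) volume) c'
      (ContinuousLinearMap.lsmul ℝ ℝ) volume t =
      convolution a' (convolution b' c' (ContinuousLinearMap.lsmul ℝ ℝ) volume)
      (ContinuousLinearMap.lsmul ℝ ℝ) volume t := by
    refine convolution_assoc _ _ _ _ (fun x y z => smul_assoc x y z) ia.1 ib.1 ic.1
      (ia.ae_convolution_exists _ ib) (ib.norm.ae_convolution_exists _ ic.norm) ?_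
    have hi := ib.norm.integrable_convolution (ContinuousLinearMap.mul ℝ ℝ) ic.norm
    have hbd : ∀ s, ‖convolution (fun x => ‖b' x‖) (fun x => ‖c' x‖)
        (ContinuousLinearMap.mul ℝ ℝ) volume s‖ ≤ ∫ x, ‖b' x‖ * M := fun s => by
      refine norm_integral_le_of_norm_le (ib.norm.mul_const M) (Eventually.of_forall fun x => ?_)
      simp only [ContinuousLinearMap.mul_apply', norm_mul, norm_norm]
      exact mul_le_mul_of_nonneg_left (hcM _) (norm_nonneg _)
    have hm := (hi.1.comp_quasiMeasurePreserving
      (quasiMeasurePreserving_sub_left_of_right_invariant volume t))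
    have := ia.norm.mul_bdd (c := ∫ x, ‖b' x‖ * M) hm (Eventually.of_forall fun s => hbd _)
    exact this
  -- The convolution of the extensions need not vanish beyond `T`, but there `t - s ≤ 0`, so the
  -- factor `c'` is zero.
  have e1 : causalConv (causalConv a b) c t =
      convolution (convolution a' b' (ContinuousLinearMap.lsmul ℝ ℝ) volume) c'
      (ContinuousLinearMap.lsmul ℝ ℝ) volume t := by
    rw [causalConv_eq_convolution _ _ ht, convolution, convolution]
    congr 1 with s
    by_cases h1 : s ∈ Ioo 0 T
    · rw [indicator_of_mem h1, causalConv_eq_convolution a b (Ioo_subset_Icc_self h1)]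
    · rw [indicator_of_notMem h1]
      rcases le_or_gt s 0 with h0 | h0
      · have : convolution a' b' (ContinuousLinearMap.lsmul ℝ ℝ) volume s = 0 := by
          rw [convolution]
          refine integral_eq_zero_of_ae (Eventually.of_forall fun x => ?_)
          by_cases hx : x ∈ Ioo 0 T
          · have : s - x ∉ Ioo 0 T := fun h => by linarith [h.1, hx.1]
            simp [hb', indicator_of_notMem this]
          · simp [ha', indicator_of_notMem hx]
        simp [this]
      · have : t - s ∉ Ioo 0 T := fun h => h1 ⟨h0, by linarith [h.1, ht.2]⟩
        simp [hc', indicator_of_notMem this]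
  have e2 : causalConv a (causalConv b c) t =
      convolution a' (convolution b' c' (ContinuousLinearMap.lsmul ℝ ℝ) volume)
      (ContinuousLinearMap.lsmul ℝ ℝ) volume t := by
    rw [causalConv_eq_convolution _ _ ht, convolution, convolution]
    congr 1 with s
    by_cases h1 : s ∈ Ioo 0 T
    · by_cases h2 : t - s ∈ Ioo 0 T
      · rw [indicator_of_mem h2, causalConv_eq_convolution b c (Ioo_subset_Icc_self h2)]
      · have h3 : t - s ≤ 0 := by
          by_contra h
          exact h2 ⟨not_le.1 h, by linarith [h1.1, ht.2]⟩
        have : convolution b' c' (ContinuousLinearMap.lsmul ℝ ℝ) volume (t - s) = 0 := by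
          rw [convolution]
          refine integral_eq_zero_of_ae (Eventually.of_forall fun x => ?_)
          by_cases hx : x ∈ Ioo 0 T
          · have : t - s - x ∉ Ioo 0 T := fun h => by linarith [h.1, hx.1]
            simp [hc', indicator_of_notMem this]
          · simp [hb', indicator_of_notMem hx]
        rw [this, indicator_of_notMem h2]
    · simp [ha', indicator_of_notMem h1]
  rw [e1, e2, key]

end CausalConvolution

/-! ### Injectivity of the Laplace transform and resolvent equations. -/

section Laplace

open ProbabilityTheory Complex in
/-- Finite measures whose moment generating functions are finite and agree on `(-∞, 1)` agree. -/
theorem measure_ext_of_mgf_eq_Iio {μ ν : Measure ℝ} [IsFiniteMeasure μ] [IsFiniteMeasure ν]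
    (hμ : Iio 1 ⊆ integrableExpSet id μ) (hν : Iio 1 ⊆ integrableExpSet id ν)
    (h : ∀ x < 1, mgf id μ x = mgf id ν x) : μ = ν := by
  have hμ' : Iio 1 ⊆ interior (integrableExpSet id μ) := interior_maximal hμ isOpen_Iio
  have hν' : Iio 1 ⊆ interior (integrableExpSet id ν) := interior_maximal hν isOpen_Iio
  -- The identity theorem spreads equality from the real points near 0 to the half-plane, which
  -- contains the imaginary axis, where the complex moment generating function is the characteristic
  -- function.
  have eq : EqOn (complexMGF id μ) (complexMGF id ν) {z | z.re < 1} := by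
    refine AnalyticOnNhd.eqOn_of_preconnected_of_frequently_eq (z₀ := ((0 : ℝ) : ℂ))
      (analyticOnNhd_complexMGF.mono fun z hz => hμ' hz)
      (analyticOnNhd_complexMGF.mono fun z hz => hν' hz)
      ((convex_Iio (1 : ℝ)).linear_preimage reLm).isPreconnected (by simp) ?_
    have h_real : ∃ᶠ (x : ℝ) in 𝓝[≠] 0, complexMGF id μ x = complexMGF id ν x := by
      refine Eventually.frequently ?_
      filter_upwards [nhdsWithin_le_nhds (Iio_mem_nhds zero_lt_one)] with x hx
      rw [complexMGF_ofReal, complexMGF_ofReal, h x hx]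
    rw [frequently_iff_seq_forall] at h_real ⊢
    obtain ⟨xs, hx_tendsto, hx_eq⟩ := h_real
    refine ⟨fun n => xs n, ?_, fun n => ?_⟩
    · rw [tendsto_nhdsWithin_iff] at hx_tendsto ⊢
      constructor
      · rw [tendsto_ofReal_iff]
        exact hx_tendsto.1
      · simpa using hx_tendsto.2
    · simp [hx_eq]
  refine Measure.ext_of_charFun (funext fun t => ?_)
  rw [← complexMGF_id_mul_I, ← complexMGF_id_mul_I]
  exact eq (by simp)

/-- The density `exp (-t) X t` defines a finite measure whose moment generating function at `x < 1`
is the Laplace transform of `X` at `1 - x > 0`. Equal transforms therefore give equal measures and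
equal densities. -/
theorem ae_eq_of_laplace_eq {X Y : ℝ → ℝ} (hX : ∀ t ∈ Ioi (0 : ℝ), 0 ≤ X t)
    (hY : ∀ t ∈ Ioi (0 : ℝ), 0 ≤ Y t)
    (iX : ∀ s > 0, IntegrableOn (fun t => Real.exp (-(s * t)) * X t) (Ioi 0))
    (iY : ∀ s > 0, IntegrableOn (fun t => Real.exp (-(s * t)) * Y t) (Ioi 0))
    (h : ∀ s > 0, ∫ t in Ioi (0 : ℝ), Real.exp (-(s * t)) * X t =
      ∫ t in Ioi (0 : ℝ), Real.exp (-(s * t)) * Y t) :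
    X =ᵐ[volume.restrict (Ioi 0)] Y := by
  set m : (ℝ → ℝ) → Measure ℝ := fun Z =>
    (volume.restrict (Ioi 0)).withDensity fun t => ENNReal.ofReal (Real.exp (-(1 * t)) * Z t)
    with hm
  have aux : ∀ Z : ℝ → ℝ, (∀ t ∈ Ioi (0 : ℝ), 0 ≤ Z t) →
      (∀ s > 0, IntegrableOn (fun t => Real.exp (-(s * t)) * Z t) (Ioi 0)) →
      IsFiniteMeasure (m Z) ∧ ∀ x < 1, x ∈ ProbabilityTheory.integrableExpSet id (m Z) ∧
        ProbabilityTheory.mgf id (m Z) x =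
          ∫ t in Ioi (0 : ℝ), Real.exp (-((1 - x) * t)) * Z t := by
    intro Z hZ iZ
    have hmeas : AEMeasurable (fun t => ENNReal.ofReal (Real.exp (-(1 * t)) * Z t))
        (volume.restrict (Ioi 0)) := (iZ 1 one_pos).1.aemeasurable.ennreal_ofReal
    have hfin : ∀ᵐ t ∂(volume.restrict (Ioi (0 : ℝ))),
        ENNReal.ofReal (Real.exp (-(1 * t)) * Z t) < ⊤ :=
      Eventually.of_forall fun _ => ENNReal.ofReal_lt_top
    have hpt : ∀ x : ℝ, ∀ t ∈ Ioi (0 : ℝ),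
        Real.exp (-((1 - x) * t)) * Z t =
        (ENNReal.ofReal (Real.exp (-(1 * t)) * Z t)).toReal • Real.exp (x * id t) := by
      intro x t ht
      rw [ENNReal.toReal_ofReal (mul_nonneg (Real.exp_pos _).le (hZ t ht)), smul_eq_mul,
        mul_right_comm, ← Real.exp_add]
      congr 2
      simp only [id]
      ring
    refine ⟨isFiniteMeasure_withDensity_ofReal (iZ 1 one_pos).2, fun x hx => ⟨?_, ?_⟩⟩
    · rw [ProbabilityTheory.integrableExpSet, mem_ofPred_eq, hm,
        integrable_withDensity_iff_integrable_smul₀' hmeas hfin]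
      exact (iZ (1 - x) (by linarith)).congr_fun (hpt x) measurableSet_Ioi
    · rw [ProbabilityTheory.mgf, hm, integral_withDensity_eq_integral_toReal_smul₀ hmeas hfin]
      exact (setIntegral_congr_fun measurableSet_Ioi (hpt x)).symm
  obtain ⟨fX, hX'⟩ := aux X hX iX
  obtain ⟨fY, hY'⟩ := aux Y hY iY
  have hm' : m X = m Y := measure_ext_of_mgf_eq_Iio (fun x hx => (hX' x hx).1)
    (fun x hx => (hY' x hx).1) fun x hx => by
      rw [(hX' x hx).2, (hY' x hx).2, h _ (by linarith)]
  rw [hm, withDensity_eq_iff_of_sigmaFinite (iX 1 one_pos).1.aemeasurable.ennreal_ofReal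
    (iY 1 one_pos).1.aemeasurable.ennreal_ofReal] at hm'
  filter_upwards [hm', ae_restrict_mem measurableSet_Ioi] with t ht h0
  rw [ENNReal.ofReal_eq_ofReal_iff (mul_nonneg (Real.exp_pos _).le (hX t h0))
    (mul_nonneg (Real.exp_pos _).le (hY t h0))] at ht
  exact mul_left_cancel₀ (Real.exp_pos _).ne' ht

theorem exp_mul_causalConv (a b : ℝ → ℝ) (s t : ℝ) :
    Real.exp (-(s * t)) * causalConv a b t =
      ∫ x in (0 : ℝ)..t, (Real.exp (-(s * x)) * a x) *
        (Real.exp (-(s * (t - x))) * b (t - x)) := by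
  rw [causalConv, ← intervalIntegral.integral_const_mul]
  congr 1 with x
  have : Real.exp (-(s * t)) = Real.exp (-(s * x)) * Real.exp (-(s * (t - x))) := by
    rw [← Real.exp_add]; congr 1; ring
  rw [this, smul_eq_mul]
  ring

/-- A resolvent equation, from the corresponding identity of Laplace transforms. -/
theorem resolvent_of_laplace {K β : ℝ → ℝ} (hK : ∀ t ∈ Ioi (0 : ℝ), 0 ≤ K t)
    (hβ : ∀ t ∈ Ioi (0 : ℝ), 0 ≤ β t)
    (iK : ∀ s > 0, IntegrableOn (fun t => Real.exp (-(s * t)) * K t) (Ioi 0))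
    (iβ : ∀ s > 0, IntegrableOn (fun t => Real.exp (-(s * t)) * β t) (Ioi 0))
    (h : ∀ s > 0, (∫ t in Ioi (0 : ℝ), Real.exp (-(s * t)) * β t) *
      (1 + ∫ t in Ioi (0 : ℝ), Real.exp (-(s * t)) * K t) =
        ∫ t in Ioi (0 : ℝ), Real.exp (-(s * t)) * K t) :
    ∀ᵐ t ∂volume.restrict (Ioi 0), β t + causalConv K β t = K t := by
  -- The exponential weight is multiplicative, so it distributes over the two factors of the
  -- convolution.
  have ic : ∀ s > 0, IntegrableOn (fun t => Real.exp (-(s * t)) * causalConv K β t) (Ioi 0) := by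
    intro s hs
    have := integrable_posConvolution (iK s hs) (iβ s hs) (ContinuousLinearMap.mul ℝ ℝ)
    rw [posConvolution, integrable_indicator_iff measurableSet_Ioi] at this
    refine this.congr_fun (fun t _ => ?_) measurableSet_Ioi
    simp only [exp_mul_causalConv, ContinuousLinearMap.mul_apply']
  refine ae_eq_of_laplace_eq (fun t ht => ?_) hK (fun s hs => ?_) iK (fun s hs => ?_)
  · refine add_nonneg (hβ t ht) (intervalIntegral.integral_nonneg_of_ae_restrict ht.le ?_)
    rw [← Measure.restrict_congr_set Ioo_ae_eq_Icc]
    filter_upwards [ae_restrict_mem measurableSet_Ioo] with x hx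
    exact mul_nonneg (hK x hx.1) (hβ _ (sub_pos.2 hx.2))
  · simp only [mul_add]
    exact (iβ s hs).add (ic s hs)
  · simp only [mul_add]
    rw [integral_add (iβ s hs) (ic s hs)]
    have := integral_posConvolution (iK s hs) (iβ s hs) (ContinuousLinearMap.mul ℝ ℝ)
    simp only [ContinuousLinearMap.mul_apply'] at this
    simp only [exp_mul_causalConv, this]
    linear_combination h s hs

end Laplace

/-! ### Stieltjes representation of the symbol by a contour integral. -/

section Stieltjes

/-- The density of the measure whose Laplace transform is `kernelB`. -/
def spectralDensity (ρ γ lam r : ℝ) : ℝ :=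
  γ / Real.pi * (lam * r ^ ρ * Real.sin (ρ * Real.pi) / kernelDenom ρ γ lam r)

/-- The Laplace transform of `kernelB`. -/
def symbol (ρ γ lam s : ℝ) : ℝ := (s + lam + lam * γ * s ^ ρ)⁻¹

theorem sin_rho_pi_pos {ρ : ℝ} (hρ : ρ ∈ Ioo (0 : ℝ) 1) : 0 < Real.sin (ρ * Real.pi) :=
  Real.sin_pos_of_pos_of_lt_pi (mul_pos hρ.1 Real.pi_pos) (by nlinarith [hρ.2, Real.pi_pos])

theorem kernelDenom_pos {ρ γ lam r : ℝ} (hρ : ρ ∈ Ioo (0 : ℝ) 1) (hγ : 0 < γ) (hl : 0 < lam)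
    (hr : 0 < r) : 0 < kernelDenom ρ γ lam r := by
  have h1 := sin_rho_pi_pos hρ
  have h2 := Real.rpow_pos_of_pos hr ρ
  unfold kernelDenom
  positivity

theorem spectralDensity_nonneg {ρ γ lam r : ℝ} (hρ : ρ ∈ Ioo (0 : ℝ) 1) (hγ : 0 < γ)
    (hl : 0 < lam) (hr : 0 < r) : 0 ≤ spectralDensity ρ γ lam r := by
  have h1 := sin_rho_pi_pos hρ
  have h2 := Real.rpow_pos_of_pos hr ρ
  have h3 := kernelDenom_pos hρ hγ hl hr
  have h4 := Real.pi_pos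
  unfold spectralDensity
  positivity

/-- The reciprocal of the symbol in the logarithmic variable. -/
def logDenom (ρ γ lam : ℝ) (w : ℂ) : ℂ :=
  Complex.exp w + lam + lam * γ * Complex.exp (ρ * w)

theorem logDenom_im (ρ γ lam : ℝ) (w : ℂ) : (logDenom ρ γ lam w).im =
    Real.exp w.re * Real.sin w.im + lam * γ * (Real.exp (ρ * w.re) * Real.sin (ρ * w.im)) := by
  simp [logDenom, Complex.exp_im, Complex.mul_im, Complex.mul_re]

theorem logDenom_ofReal (ρ γ lam : ℝ) (x : ℝ) : logDenom ρ γ lam x =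
    ((Real.exp x + lam + lam * γ * Real.exp (ρ * x) : ℝ) : ℂ) := by
  simp [logDenom]

/-- In the closed strip `sin (Im w)` never has the sign opposite to that of `sin (ρ Im w)`, and the
latter is nonzero off the real axis because `ρ < 1`; so the imaginary part does not vanish there. On
the real axis all terms are positive. -/
theorem logDenom_ne_zero {ρ γ lam : ℝ} (hρ : ρ ∈ Ioo (0 : ℝ) 1) (hγ : 0 < γ) (hl : 0 < lam)
    {w : ℂ} (hw : w.im ∈ Icc (-Real.pi) Real.pi) : logDenom ρ γ lam w ≠ 0 := by
  have hpi := Real.pi_pos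
  rcases lt_trichotomy w.im 0 with h | h | h
  · intro h0
    have h1 : Real.sin w.im ≤ 0 := Real.sin_nonpos_of_nonpos_of_neg_pi_le h.le hw.1
    have h2 : Real.sin (ρ * w.im) < 0 := Real.sin_neg_of_neg_of_neg_pi_lt
      (mul_neg_of_pos_of_neg hρ.1 h) (by nlinarith [hρ.1, hρ.2, hw.1])
    have h3 := logDenom_im ρ γ lam w
    rw [h0, Complex.zero_im] at h3
    have h4 := mul_nonneg (Real.exp_pos w.re).le (neg_nonneg.2 h1)
    have h5 := mul_pos (mul_pos hl hγ) (mul_pos (Real.exp_pos (ρ * w.re)) (neg_pos.2 h2))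
    linarith
  · have : w = (w.re : ℂ) := by apply Complex.ext <;> simp [h]
    rw [this, logDenom_ofReal]
    have := Real.exp_pos w.re
    have := Real.exp_pos (ρ * w.re)
    exact_mod_cast (by positivity : Real.exp w.re + lam + lam * γ * Real.exp (ρ * w.re) ≠ 0)
  · intro h0
    have h1 : 0 ≤ Real.sin w.im := Real.sin_nonneg_of_nonneg_of_le_pi h.le hw.2
    have h2 : 0 < Real.sin (ρ * w.im) := Real.sin_pos_of_pos_of_lt_pi
      (mul_pos hρ.1 h) (by nlinarith [hρ.1, hρ.2, hw.2])
    have h3 := logDenom_im ρ γ lam w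
    rw [h0, Complex.zero_im] at h3
    have h4 := mul_nonneg (Real.exp_pos w.re).le h1
    have h5 := mul_pos (mul_pos hl hγ) (mul_pos (Real.exp_pos (ρ * w.re)) h2)
    linarith

theorem logDenom_add_pi (ρ γ lam x : ℝ) : logDenom ρ γ lam (x + Real.pi * Complex.I) =
    ((-Real.exp x + lam * γ * Real.exp x ^ ρ * Real.cos (ρ * Real.pi) + lam : ℝ) : ℂ) +
      ((lam * γ * Real.exp x ^ ρ * Real.sin (ρ * Real.pi) : ℝ) : ℂ) * Complex.I := by
  have h : (ρ : ℂ) * (x + Real.pi * Complex.I) =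
    ((ρ * x : ℝ) : ℂ) + ((ρ * Real.pi : ℝ) : ℂ) * Complex.I := by push_cast; ring
  rw [logDenom, h, Complex.exp_add, Complex.exp_add, Complex.exp_pi_mul_I, Complex.exp_mul_I,
    ← Real.exp_mul, mul_comm x ρ]
  push_cast
  ring

theorem logDenom_sub_pi (ρ γ lam x : ℝ) : logDenom ρ γ lam (x + (-Real.pi : ℝ) * Complex.I) =
    ((-Real.exp x + lam * γ * Real.exp x ^ ρ * Real.cos (ρ * Real.pi) + lam : ℝ) : ℂ) -
      ((lam * γ * Real.exp x ^ ρ * Real.sin (ρ * Real.pi) : ℝ) : ℂ) * Complex.I := by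
  have h : (ρ : ℂ) * (x + (-Real.pi : ℝ) * Complex.I) =
    ((ρ * x : ℝ) : ℂ) + (-(ρ * Real.pi : ℝ) : ℂ) * Complex.I := by push_cast; ring
  have h2 : Complex.exp ((-Real.pi : ℝ) * Complex.I) = -1 := by
    push_cast
    rw [neg_mul, Complex.exp_neg, Complex.exp_pi_mul_I]
    norm_num
  rw [logDenom, h, Complex.exp_add, Complex.exp_add, h2, Complex.exp_mul_I,
    ← Real.exp_mul, mul_comm x ρ, Complex.cos_neg, Complex.sin_neg]
  push_cast
  ring

/-- The values on the two edges are conjugate numbers `p - iq` and `p + iq`, with `p ^ 2 + q ^ 2`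
equal to `kernelDenom`, so the inverses differ by `2iq / (p ^ 2 + q ^ 2)`. -/
theorem inv_logDenom_jump {ρ γ lam : ℝ} (hρ : ρ ∈ Ioo (0 : ℝ) 1) (hγ : 0 < γ) (hl : 0 < lam)
    (x : ℝ) : (logDenom ρ γ lam (x + (-Real.pi : ℝ) * Complex.I))⁻¹ -
      (logDenom ρ γ lam (x + Real.pi * Complex.I))⁻¹ =
      2 * Real.pi * Complex.I * (spectralDensity ρ γ lam (Real.exp x) : ℝ) := by
  have h1 := logDenom_ne_zero hρ hγ hl (w := x + (-Real.pi : ℝ) * Complex.I)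
    (by simp [Real.pi_pos.le])
  have h2 := logDenom_ne_zero hρ hγ hl (w := x + Real.pi * Complex.I)
    (by simp [Real.pi_pos.le])
  rw [logDenom_sub_pi] at h1 ⊢
  rw [logDenom_add_pi] at h2 ⊢
  have hk := (kernelDenom_pos hρ hγ hl (Real.exp_pos x)).ne'
  unfold spectralDensity
  unfold kernelDenom at hk ⊢
  set p := -Real.exp x + lam * γ * Real.exp x ^ ρ * Real.cos (ρ * Real.pi) + lam
  set q := lam * γ * Real.exp x ^ ρ * Real.sin (ρ * Real.pi) with hq
  have hm : ((p : ℂ) - q * Complex.I) * (p + q * Complex.I) = ((p ^ 2 + q ^ 2 : ℝ) : ℂ) := by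
    push_cast
    linear_combination (-(q : ℂ) ^ 2) * Complex.I_sq
  have e : γ / Real.pi * (lam * Real.exp x ^ ρ * Real.sin (ρ * Real.pi) / (p ^ 2 + q ^ 2)) =
      q / Real.pi / (p ^ 2 + q ^ 2) := by rw [hq]; ring
  rw [e, inv_sub_inv h1 h2, hm]
  have hk' : ((p ^ 2 + q ^ 2 : ℝ) : ℂ) ≠ 0 := Complex.ofReal_ne_zero.2 hk
  have hpi : (Real.pi : ℂ) ≠ 0 := Complex.ofReal_ne_zero.2 Real.pi_ne_zero
  rw [Complex.ofReal_div, Complex.ofReal_div]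
  field_simp
  ring

/-- The first bound serves the edge of the rectangle going to `+∞`, where `exp w` dominates; the
second serves the edge going to `-∞`, where `lam` dominates. -/
theorem norm_logDenom_ge_of_re {ρ γ lam : ℝ} (hγ : 0 < γ) (hl : 0 < lam) (x y : ℝ) :
    Real.exp x - lam - lam * γ * Real.exp (ρ * x) ≤ ‖logDenom ρ γ lam (x + y * Complex.I)‖ ∧
    lam - Real.exp x - lam * γ * Real.exp (ρ * x) ≤ ‖logDenom ρ γ lam (x + y * Complex.I)‖ := by
  have e1 : ‖Complex.exp (x + y * Complex.I)‖ = Real.exp x := by simp [Complex.norm_exp]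
  have e2 : ‖Complex.exp (ρ * (x + y * Complex.I))‖ = Real.exp (ρ * x) := by
    simp [Complex.norm_exp]
  have e3 : ‖(lam : ℂ) * γ * Complex.exp (ρ * (x + y * Complex.I))‖ =
      lam * γ * Real.exp (ρ * x) := by
    rw [norm_mul, norm_mul, e2, Complex.norm_real, Complex.norm_real, Real.norm_of_nonneg hl.le,
      Real.norm_of_nonneg hγ.le]
  have e4 : ‖(lam : ℂ)‖ = lam := by rw [Complex.norm_real, Real.norm_of_nonneg hl.le]
  set E := Complex.exp (x + y * Complex.I)
  set F := (lam : ℂ) * γ * Complex.exp (ρ * (x + y * Complex.I))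
  have hD : logDenom ρ γ lam (x + y * Complex.I) = E + lam + F := rfl
  rw [hD]
  have n1 := norm_sub_le (E + lam + F) ((lam : ℂ) + F)
  have n2 := norm_add_le (lam : ℂ) F
  have n3 := norm_sub_le (E + lam + F) (E + F)
  have n4 := norm_add_le E F
  rw [show E + lam + F - ((lam : ℂ) + F) = E by ring] at n1
  rw [show E + lam + F - (E + F) = (lam : ℂ) by ring] at n3
  constructor <;> linarith

theorem continuous_spectralDensity_exp {ρ γ lam : ℝ} (hρ : ρ ∈ Ioo (0 : ℝ) 1) (hγ : 0 < γ)
    (hl : 0 < lam) : Continuous fun x => spectralDensity ρ γ lam (Real.exp x) := by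
  unfold spectralDensity
  have hk : ∀ x, kernelDenom ρ γ lam (Real.exp x) ≠ 0 := fun x =>
    (kernelDenom_pos hρ hγ hl (Real.exp_pos x)).ne'
  refine continuous_const.mul (Continuous.div ?_ ?_ hk)
  · simp only [← Real.exp_mul]; fun_prop
  · unfold kernelDenom; simp only [← Real.exp_mul]; fun_prop

/-- The contour integral identity behind the Stieltjes representation of the symbol. -/
theorem tendsto_stieltjes_exp {ρ γ lam s : ℝ} (hρ : ρ ∈ Ioo (0 : ℝ) 1) (hγ : 0 < γ)
    (hl : 0 < lam) (hs : 0 < s) :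
    Tendsto (fun R : ℝ => ∫ x in -R..R,
      Real.exp x * (spectralDensity ρ γ lam (Real.exp x) / (Real.exp x + s)))
      atTop (𝓝 (symbol ρ γ lam s)) := by
  have hpi := Real.pi_pos
  set D := logDenom ρ γ lam with hD
  set w₀ : ℂ := ((Real.log s : ℝ) : ℂ) with hw₀
  set g : ℂ → ℂ := fun w => (D w)⁻¹ with hg
  have hexp0 : Complex.exp w₀ = s := by
    rw [hw₀, ← Complex.ofReal_exp, Real.exp_log hs]
  have hg0 : g w₀ = (symbol ρ γ lam s : ℝ) := by
    simp only [hg, hD, hw₀, logDenom_ofReal, symbol]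
    rw [Real.exp_log hs, mul_comm ρ, Real.exp_mul, Real.exp_log hs]
    push_cast
    ring
  set S : Set ℂ := {w | w.im ∈ Icc (-Real.pi) Real.pi} with hS
  have hSn : S ∈ 𝓝 w₀ := by
    refine Complex.continuous_im.continuousAt.preimage_mem_nhds (Icc_mem_nhds ?_ ?_) <;>
      simp [hw₀, hpi]
  have hDd : Differentiable ℂ D := by
    intro w
    simp only [hD]
    unfold logDenom
    fun_prop
  have hgd : DifferentiableOn ℂ g S := fun w hw =>
    ((hDd w).inv (logDenom_ne_zero hρ hγ hl hw)).differentiableWithinAt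
  have hexp_ne : ∀ w ∈ S, w ≠ w₀ → Complex.exp w ≠ s := by
    intro w hw hne h
    rw [← hexp0, Complex.exp_eq_exp_iff_exists_int] at h
    obtain ⟨n, hn⟩ := h
    have him : w.im = n * (2 * Real.pi) := by
      rw [hn]; simp [hw₀]
    have h1 := hw.1
    have h2 := hw.2
    rw [him] at h1 h2
    have hn0 : n = 0 := by
      have a1 : (-1 : ℝ) < n := by nlinarith
      have a2 : (n : ℝ) < 1 := by nlinarith
      have b1 : (-1 : ℤ) < n := by exact_mod_cast a1
      have b2 : n < (1 : ℤ) := by exact_mod_cast a2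
      omega
    apply hne
    rw [hn, hn0]
    simp
  -- Subtracting `g w₀` removes the pole of `1 / (exp w - s)` at `w₀ = log s`; the quotient of
  -- `dslope`s is the holomorphic extension. The subtracted term cancels in the jump, since `exp w`
  -- takes the same value on both edges.
  set f : ℂ → ℂ := fun w => Complex.exp w * dslope g w₀ w / dslope Complex.exp w₀ w with hf
  have hf_eq : ∀ w, w ≠ w₀ → f w = Complex.exp w * (g w - g w₀) / (Complex.exp w - s) := by
    intro w hw
    simp only [hf, dslope_of_ne _ hw, slope_def_field, hexp0]
    have := sub_ne_zero.2 hw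
    rw [mul_div_assoc, mul_div_assoc, div_div_div_cancel_right₀ this]
  have hfd : DifferentiableOn ℂ f S := by
    refine DifferentiableOn.div (Complex.differentiable_exp.differentiableOn.mul
      ((Complex.differentiableOn_dslope hSn).2 hgd))
      ((Complex.differentiableOn_dslope hSn).2 Complex.differentiable_exp.differentiableOn) ?_
    intro w hw
    by_cases h : w = w₀
    · rw [h, dslope_same, Complex.deriv_exp]
      exact Complex.exp_ne_zero _
    · rw [dslope_of_ne _ h, slope_def_field, hexp0]
      exact div_ne_zero (sub_ne_zero.2 (hexp_ne w hw h)) (sub_ne_zero.2 h)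
  set j : ℝ → ℝ := fun x =>
    Real.exp x * (spectralDensity ρ γ lam (Real.exp x) / (Real.exp x + s)) with hj
  have hjump : ∀ x : ℝ, f (x + (-Real.pi : ℝ) * Complex.I) - f (x + Real.pi * Complex.I) =
      2 * Real.pi * Complex.I * (j x : ℝ) := by
    intro x
    rw [hf_eq, hf_eq]
    · have := inv_logDenom_jump hρ hγ hl x
      have h2 : Complex.exp (x + (-Real.pi : ℝ) * Complex.I) = -Real.exp x := by
        push_cast
        rw [neg_mul, Complex.exp_add, Complex.exp_neg, Complex.exp_pi_mul_I]
        norm_num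
      have h3 : Complex.exp (x + Real.pi * Complex.I) = -Real.exp x := by
        rw [Complex.exp_add, Complex.exp_pi_mul_I]
        push_cast
        ring
      have h4 : (Real.exp x : ℂ) + s ≠ 0 := by
        have := Real.exp_pos x
        exact_mod_cast (by positivity : Real.exp x + s ≠ 0)
      have h5 : -(Real.exp x : ℂ) - s ≠ 0 := by
        intro h; apply h4; linear_combination -h
      rw [h2, h3, ← sub_div, ← mul_sub, sub_sub_sub_cancel_right]
      simp only [hg, hD]
      rw [this]
      simp only [hj]
      push_cast at h4 h5 ⊢
      rw [div_eq_iff h5]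
      field_simp
      ring
    · intro h
      have := congrArg Complex.im h
      simp [hw₀, hpi.ne'] at this
    · intro h
      have := congrArg Complex.im h
      simp [hw₀, hpi.ne'] at this
  have hline : ∀ y ∈ Icc (-Real.pi) Real.pi, Continuous fun x : ℝ => f (x + (y : ℝ) * Complex.I) :=
    fun y hy => hfd.continuousOn.comp_continuous (by fun_prop) fun x => by simpa [hS] using hy
  have hvert : ∀ x : ℝ, IntervalIntegrable (fun y : ℝ => f (x + y * Complex.I)) volume
      (-Real.pi) Real.pi := fun x => by
    refine ContinuousOn.intervalIntegrable ?_
    rw [uIcc_of_le (by linarith)]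
    exact hfd.continuousOn.comp (by fun_prop) fun y hy => by simpa [hS] using hy
  -- Cauchy's theorem on the rectangle `[-R, R] × [-π, π]`; the horizontal edges combine into the
  -- jump.
  have hrect : ∀ R : ℝ, (2 * Real.pi * Complex.I) * ((∫ x in -R..R, j x : ℝ) : ℂ) +
      Complex.I * (∫ y : ℝ in -Real.pi..Real.pi, f ((R : ℝ) + y * Complex.I)) -
      Complex.I * (∫ y : ℝ in -Real.pi..Real.pi, f ((-R : ℝ) + y * Complex.I)) = 0 := by
    intro R
    have := Complex.integral_boundary_rect_eq_zero_of_differentiableOn f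
      (⟨-R, -Real.pi⟩ : ℂ) ⟨R, Real.pi⟩ (hfd.mono fun w hw => by
        have := hw.2
        rw [uIcc_of_le (by simp only; linarith)] at this
        exact this)
    simp only [smul_eq_mul] at this
    rw [← intervalIntegral.integral_sub
      ((hline (-Real.pi) (by simp [hpi.le])).intervalIntegrable _ _)
      ((hline Real.pi (by simp [hpi.le])).intervalIntegrable _ _)] at this
    simp only [hjump] at this
    rw [intervalIntegral.integral_const_mul, intervalIntegral.integral_ofReal] at this
    exact this
  have hρ0 := hρ.1
  have t1 : Tendsto (fun R : ℝ => Real.exp R) atTop atTop := Real.tendsto_exp_atTop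
  have t2 : Tendsto (fun R : ℝ => Real.exp (-R)) atTop (𝓝 0) := Real.tendsto_exp_neg_atTop_nhds_zero
  have t3 : Tendsto (fun R : ℝ => Real.exp (ρ * R) / Real.exp R) atTop (𝓝 0) := by
    have : Tendsto (fun R : ℝ => Real.exp (-((1 - ρ) * R))) atTop (𝓝 0) :=
      Real.tendsto_exp_neg_atTop_nhds_zero.comp
        (tendsto_id.const_mul_atTop (by linarith [hρ.2] : 0 < 1 - ρ))
    refine this.congr fun R => ?_
    rw [← Real.exp_sub]
    congr 1
    ring
  have t4 : Tendsto (fun R : ℝ => Real.exp (ρ * -R)) atTop (𝓝 0) := by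
    have : Tendsto (fun R : ℝ => Real.exp (-(ρ * R))) atTop (𝓝 0) :=
      Real.tendsto_exp_neg_atTop_nhds_zero.comp (tendsto_id.const_mul_atTop hρ0)
    refine this.congr fun R => ?_
    congr 1
    ring
  have t5 : Tendsto (fun R : ℝ => (Real.exp R)⁻¹) atTop (𝓝 0) := tendsto_inv_atTop_zero.comp t1
  -- On the right edge `f` tends uniformly to `-g w₀`, so this vertical edge supplies the value of
  -- the symbol; on the left edge `f` tends to 0 with the factor `exp w`.
  have hright : Tendsto (fun R : ℝ => ∫ y : ℝ in -Real.pi..Real.pi, f ((R : ℝ) + y * Complex.I))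
      atTop (𝓝 (-(2 * Real.pi) * g w₀)) := by
    set bd : ℝ → ℝ := fun R =>
      ((1 - lam * (Real.exp R)⁻¹ - lam * γ * (Real.exp (ρ * R) / Real.exp R))⁻¹ * (Real.exp R)⁻¹
        + s * ‖g w₀‖ * (Real.exp R)⁻¹) / (1 - s * (Real.exp R)⁻¹) with hbd
    have hbd0 : Tendsto bd atTop (𝓝 0) := by
      have : Tendsto bd atTop (𝓝 (((1 - lam * 0 - lam * γ * 0)⁻¹ * 0 + s * ‖g w₀‖ * 0) /
          (1 - s * 0))) :=
        ((((tendsto_const_nhds (x := (1 : ℝ))).sub (t5.const_mul lam)).sub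
        (t3.const_mul (lam * γ))).inv₀ (by simp)).mul t5 |>.add (t5.const_mul (s * ‖g w₀‖)) |>.div
        ((tendsto_const_nhds (x := (1 : ℝ))).sub (t5.const_mul s)) (by simp)
      simpa using this
    have hpos1 : ∀ᶠ R : ℝ in atTop,
        0 < 1 - lam * (Real.exp R)⁻¹ - lam * γ * (Real.exp (ρ * R) / Real.exp R) := by
      have := ((tendsto_const_nhds (x := (1 : ℝ))).sub (t5.const_mul lam)).sub
        (t3.const_mul (lam * γ))
      exact this.eventually (lt_mem_nhds (by simp))
    rw [← tendsto_sub_nhds_zero_iff]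
    refine squeeze_zero_norm' ?_ (by simpa using hbd0.mul_const (2 * Real.pi))
    filter_upwards [hpos1, t1.eventually (eventually_gt_atTop s)] with R hR1 hR2
    have e : (∫ y : ℝ in -Real.pi..Real.pi, f ((R : ℝ) + y * Complex.I)) -
        -(2 * Real.pi) * g w₀ =
        ∫ y : ℝ in -Real.pi..Real.pi, (f ((R : ℝ) + y * Complex.I) + g w₀) := by
      rw [intervalIntegral.integral_add (hvert R) intervalIntegrable_const,
        intervalIntegral.integral_const]
      simp only [Complex.real_smul]
      push_cast
      ring
    rw [e]
    have hb : ∀ y ∈ uIoc (-Real.pi) Real.pi, ‖f ((R : ℝ) + y * Complex.I) + g w₀‖ ≤ bd R := by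
      intro y hy
      rw [uIoc_of_le (by linarith)] at hy
      set w : ℂ := (R : ℝ) + y * Complex.I with hw
      have hER := Real.exp_pos R
      have hne : w ≠ w₀ := by
        intro h
        have := congrArg Complex.re h
        simp [hw, hw₀] at this
        rw [this, Real.exp_log hs] at hR2
        exact lt_irrefl _ hR2
      have hwS : w ∈ S := by
        simp only [hS, mem_ofPred_eq, hw]
        simpa using Ioc_subset_Icc_self hy
      have hne' : Complex.exp w - s ≠ 0 := sub_ne_zero.2 (hexp_ne w hwS hne)
      have e1 : ‖Complex.exp w‖ = Real.exp R := by simp [hw, Complex.norm_exp]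
      have e2 : f w + g w₀ = (Complex.exp w * g w - s * g w₀) / (Complex.exp w - s) := by
        rw [hf_eq w hne]
        field_simp
        ring
      have e3 : Real.exp R - s ≤ ‖Complex.exp w - s‖ := by
        have := norm_sub_norm_le (Complex.exp w) s
        rwa [e1, Complex.norm_real, Real.norm_of_nonneg hs.le] at this
      have e4 := (norm_logDenom_ge_of_re (ρ := ρ) hγ hl R y).1
      have e5 : 0 < Real.exp R - lam - lam * γ * Real.exp (ρ * R) := by
        have := mul_pos hER hR1
        field_simp at this
        linarith
      have e6 : ‖g w‖ ≤ (Real.exp R - lam - lam * γ * Real.exp (ρ * R))⁻¹ := by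
        simp only [hg, norm_inv]
        exact inv_anti₀ e5 e4
      have e7 : ‖Complex.exp w * g w - s * g w₀‖ ≤
          Real.exp R * (Real.exp R - lam - lam * γ * Real.exp (ρ * R))⁻¹ + s * ‖g w₀‖ := by
        refine (norm_sub_le _ _).trans ?_
        rw [norm_mul, norm_mul, e1, Complex.norm_real, Real.norm_of_nonneg hs.le]
        gcongr
      rw [e2, norm_div]
      calc _ ≤ (Real.exp R * (Real.exp R - lam - lam * γ * Real.exp (ρ * R))⁻¹ + s * ‖g w₀‖) /
            (Real.exp R - s) :=
          div_le_div₀ ((norm_nonneg _).trans e7) e7 (by linarith) e3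
        _ = bd R := by
          simp only [hbd]
          have e8 : Real.exp R - s ≠ 0 := by linarith
          have e9 : 1 - s * (Real.exp R)⁻¹ = (Real.exp R - s) / Real.exp R := by
            field_simp
          have e10 : 1 - lam * (Real.exp R)⁻¹ - lam * γ * (Real.exp (ρ * R) / Real.exp R) =
              (Real.exp R - lam - lam * γ * Real.exp (ρ * R)) / Real.exp R := by
            field_simp
          rw [e9, e10]
          have e11 := e5.ne'
          field_simp
    refine (intervalIntegral.norm_integral_le_of_norm_le_const hb).trans (le_of_eq ?_)
    rw [abs_of_nonneg (by linarith)]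
    ring
  have hleft : Tendsto (fun R : ℝ => ∫ y : ℝ in -Real.pi..Real.pi, f ((-R : ℝ) + y * Complex.I))
      atTop (𝓝 0) := by
    set bd : ℝ → ℝ := fun R => Real.exp (-R) * ((lam - Real.exp (-R) -
      lam * γ * Real.exp (ρ * -R))⁻¹ + ‖g w₀‖) / (s - Real.exp (-R)) with hbd
    have hden : Tendsto (fun R : ℝ => lam - Real.exp (-R) - lam * γ * Real.exp (ρ * -R)) atTop
        (𝓝 lam) := by
      simpa using ((tendsto_const_nhds (x := lam)).sub t2).sub (t4.const_mul (lam * γ))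
    have hbd0 : Tendsto bd atTop (𝓝 0) := by
      have : Tendsto bd atTop (𝓝 (0 * (lam⁻¹ + ‖g w₀‖) / (s - 0))) :=
        (t2.mul ((hden.inv₀ hl.ne').add_const ‖g w₀‖)).div
        ((tendsto_const_nhds (x := s)).sub t2) (by simpa using hs.ne')
      simpa using this
    refine squeeze_zero_norm' ?_ (by simpa using hbd0.mul_const (2 * Real.pi))
    filter_upwards [hden.eventually (lt_mem_nhds hl), t2.eventually (gt_mem_nhds hs)] with R hR1 hR2
    have hb : ∀ y ∈ uIoc (-Real.pi) Real.pi, ‖f ((-R : ℝ) + y * Complex.I)‖ ≤ bd R := by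
      intro y hy
      rw [uIoc_of_le (by linarith)] at hy
      set w : ℂ := (-R : ℝ) + y * Complex.I with hw
      have hne : w ≠ w₀ := by
        intro h
        have := congrArg Complex.re h
        simp [hw, hw₀] at this
        rw [this, Real.exp_log hs] at hR2
        exact lt_irrefl _ hR2
      have e1 : ‖Complex.exp w‖ = Real.exp (-R) := by simp [hw, Complex.norm_exp]
      have e3 : s - Real.exp (-R) ≤ ‖Complex.exp w - s‖ := by
        have := norm_sub_norm_le (s : ℂ) (Complex.exp w)
        rwa [e1, Complex.norm_real, Real.norm_of_nonneg hs.le, norm_sub_rev] at this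
      have e4 := (norm_logDenom_ge_of_re (ρ := ρ) hγ hl (-R) y).2
      have e6 : ‖g w‖ ≤ (lam - Real.exp (-R) - lam * γ * Real.exp (ρ * -R))⁻¹ := by
        simp only [hg, norm_inv]
        exact inv_anti₀ hR1 e4
      rw [hf_eq w hne, norm_div, norm_mul, e1]
      refine div_le_div₀ ?_ ?_ (by linarith) e3
      · exact mul_nonneg (Real.exp_pos _).le (add_nonneg (inv_nonneg.2 hR1.le) (norm_nonneg _))
      · exact mul_le_mul_of_nonneg_left ((norm_sub_le _ _).trans (by gcongr)) (Real.exp_pos _).le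
    refine (intervalIntegral.norm_integral_le_of_norm_le_const hb).trans (le_of_eq ?_)
    rw [abs_of_nonneg (by linarith)]
    ring
  have hlim := ((hleft.sub hright).div_const (2 * Real.pi : ℂ))
  have hpi' : (Real.pi : ℂ) ≠ 0 := Complex.ofReal_ne_zero.2 hpi.ne'
  rw [show (0 - -(2 * Real.pi : ℂ) * g w₀) / (2 * Real.pi) = g w₀ by field_simp; ring, hg0] at hlim
  have hc := (Complex.continuous_re.tendsto _).comp hlim
  rw [Complex.ofReal_re] at hc
  refine hc.congr fun R => ?_
  have := hrect R
  rw [Function.comp, show (∫ y : ℝ in -Real.pi..Real.pi, f ((-R : ℝ) + y * Complex.I)) -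
    (∫ y : ℝ in -Real.pi..Real.pi, f ((R : ℝ) + y * Complex.I)) =
    2 * Real.pi * ((∫ x in -R..R, j x : ℝ) : ℂ) from ?_]
  · rw [mul_div_cancel_left₀ _ (mul_ne_zero two_ne_zero hpi'), Complex.ofReal_re]
  · apply mul_left_cancel₀ Complex.I_ne_zero
    linear_combination -this

/-- Substitution `r = exp x`. The integrand is nonnegative, so convergence of the truncated
integrals already gives integrability. -/
theorem stieltjes {ρ γ lam s : ℝ} (hρ : ρ ∈ Ioo (0 : ℝ) 1) (hγ : 0 < γ)
    (hl : 0 < lam) (hs : 0 < s) :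
    IntegrableOn (fun r => spectralDensity ρ γ lam r / (r + s)) (Ioi 0) ∧
      ∫ r in Ioi (0 : ℝ), spectralDensity ρ γ lam r / (r + s) = symbol ρ γ lam s := by
  have h := tendsto_stieltjes_exp hρ hγ hl hs
  set j : ℝ → ℝ := fun x =>
    Real.exp x * (spectralDensity ρ γ lam (Real.exp x) / (Real.exp x + s)) with hj
  have hjc : Continuous j := Real.continuous_exp.mul
    ((continuous_spectralDensity_exp hρ hγ hl).div (by fun_prop) fun x => by positivity)
  have hj0 : ∀ x, 0 ≤ j x := fun x => mul_nonneg (Real.exp_pos x).le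
    (div_nonneg (spectralDensity_nonneg hρ hγ hl (Real.exp_pos x)) (by positivity))
  have hji : Integrable j := by
    refine integrable_of_intervalIntegral_norm_tendsto (symbol ρ γ lam s)
      (fun R : ℝ => (hjc.integrableOn_Icc (a := -R) (b := R)).mono_set Ioc_subset_Icc_self)
      tendsto_neg_atTop_atBot tendsto_id ?_
    simpa only [Real.norm_of_nonneg (hj0 _)] using h
  have hjI := tendsto_nhds_unique
    (intervalIntegral_tendsto_integral hji tendsto_neg_atTop_atBot tendsto_id) h
  have himg : Real.exp '' univ = Ioi 0 := by rw [image_univ, Real.range_exp]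
  have hder : ∀ x ∈ (univ : Set ℝ), HasDerivWithinAt Real.exp (Real.exp x) univ x :=
    fun x _ => (Real.hasDerivAt_exp x).hasDerivWithinAt
  constructor
  · rw [← himg, integrableOn_image_iff_integrableOn_abs_deriv_smul MeasurableSet.univ hder
      Real.exp_injective.injOn]
    simpa [hj, integrableOn_univ] using hji
  · rw [← himg, integral_image_eq_integral_abs_deriv_smul MeasurableSet.univ hder
      Real.exp_injective.injOn, ← hjI]
    simp [hj]

end Stieltjes

/-! ### Moments, bounds and the resolvent identity for the kernels. -/

section Kernels

/-- Monotone convergence in which integrability of the limit is a conclusion, drawn by Fatou from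
convergence of the integrals. It extracts moments of the spectral density from limits of the
Stieltjes representation. -/
theorem integrable_and_integral_eq_of_monotone_tendsto {μ : Measure ℝ}
    {F : ℕ → ℝ → ℝ} {f : ℝ → ℝ} {L : ℝ} (hF : ∀ n, Integrable (F n) μ)
    (hF0 : ∀ n, ∀ᵐ x ∂μ, 0 ≤ F n x) (hmono : ∀ᵐ x ∂μ, Monotone fun n => F n x)
    (hlim : ∀ᵐ x ∂μ, Tendsto (fun n => F n x) atTop (𝓝 (f x)))
    (hL : Tendsto (fun n => ∫ x, F n x ∂μ) atTop (𝓝 L)) :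
    Integrable f μ ∧ ∫ x, f x ∂μ = L := by
  have hf : Integrable f μ := by
    refine integrable_of_tendsto hlim (fun n => (hF n).1) ?_
    have h : Tendsto (fun n => ∫⁻ x, ‖F n x‖ₑ ∂μ) atTop (𝓝 (ENNReal.ofReal L)) := by
      refine (ENNReal.continuous_ofReal.tendsto L).comp hL |>.congr fun n => ?_
      rw [Function.comp, ofReal_integral_eq_lintegral_ofReal (hF n) (hF0 n)]
      refine lintegral_congr_ae ((hF0 n).mono fun x hx => ?_)
      exact (Real.enorm_of_nonneg hx).symm
    rw [h.liminf_eq]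
    exact ENNReal.ofReal_ne_top
  exact ⟨hf, tendsto_nhds_unique (integral_tendsto_of_tendsto_of_monotone hF hf hmono hlim) hL⟩

/-- Tonelli's theorem for a family of kernels weighted by a nonnegative function. -/
theorem integrableOn_and_integral_of_weight {S : Set ℝ} (hS : MeasurableSet S) {w E : ℝ → ℝ}
    {e : ℝ → ℝ → ℝ} (he : Continuous (Function.uncurry e))
    (hw : AEStronglyMeasurable w (volume.restrict (Ioi 0)))
    (he0 : ∀ r ∈ Ioi (0 : ℝ), ∀ s ∈ S, 0 ≤ e r s)
    (hi : ∀ r ∈ Ioi (0 : ℝ), IntegrableOn (e r) S)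
    (hE : ∀ r ∈ Ioi (0 : ℝ), ∫ s in S, e r s = E r)
    (hEw : IntegrableOn (fun r => E r * w r) (Ioi 0)) :
    IntegrableOn (fun s => ∫ r in Ioi (0 : ℝ), e r s * w r) S ∧
      ∫ s in S, ∫ r in Ioi (0 : ℝ), e r s * w r = ∫ r in Ioi (0 : ℝ), E r * w r := by
  have hint : Integrable (Function.uncurry fun r s => e r s * w r)
      ((volume.restrict (Ioi 0)).prod (volume.restrict S)) := by
    have hm : AEStronglyMeasurable (Function.uncurry fun r s => e r s * w r)
        ((volume.restrict (Ioi 0)).prod (volume.restrict S)) :=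
      he.aestronglyMeasurable.mul hw.comp_fst
    rw [integrable_prod_iff hm]
    constructor
    · filter_upwards [ae_restrict_mem measurableSet_Ioi] with r hr
      exact Integrable.mul_const (hi r hr) (w r)
    · refine hEw.norm.congr ?_
      filter_upwards [ae_restrict_mem measurableSet_Ioi] with r hr
      simp only [Function.uncurry_apply_pair, norm_mul]
      rw [integral_mul_const]
      congr 1
      rw [← hE r hr, Real.norm_of_nonneg (setIntegral_nonneg hS (he0 r hr))]
      exact setIntegral_congr_fun hS fun s hs => (Real.norm_of_nonneg (he0 r hr s hs)).symm
  refine ⟨hint.integral_prod_right, ?_⟩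
  rw [← integral_integral_swap hint]
  refine setIntegral_congr_fun measurableSet_Ioi fun r hr => ?_
  simp only [integral_mul_const, hE r hr]

/-- `-(d/dt) kernelB`. -/
def kernelD (ρ γ lam t : ℝ) : ℝ :=
  ∫ r in Ioi (0 : ℝ), Real.exp (-r * t) * (r * spectralDensity ρ γ lam r)

/-- The kernel of the Volterra equation satisfied by the derivative of a solution. -/
def volterraKernel (ρ γ lam t : ℝ) : ℝ :=
  lam * (1 + γ * ((1 / Real.Gamma (1 - ρ)) * t ^ (-ρ)))

theorem kernelB_eq (ρ γ lam t : ℝ) : kernelB ρ γ lam t =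
    ∫ r in Ioi (0 : ℝ), Real.exp (-r * t) * spectralDensity ρ γ lam r := by
  rw [kernelB, ← integral_const_mul]
  congr 1 with r
  unfold spectralDensity
  ring

theorem kernelA_eq (ρ γ lam t : ℝ) : kernelA ρ γ lam t =
    ∫ r in Ioi (0 : ℝ), Real.exp (-r * t) * (lam * (spectralDensity ρ γ lam r / r)) := by
  rw [kernelA, ← integral_const_mul]
  refine setIntegral_congr_fun measurableSet_Ioi fun r hr => ?_
  rw [Real.rpow_sub_one (ne_of_gt hr)]
  unfold spectralDensity
  ring

variable {ρ γ lam : ℝ}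

/-- As `s → ∞`, `s / (r + s)` increases to 1 while `s * symbol s` tends to 1, because `s ^ ρ / s →
0`. -/
theorem spectralDensity_integrable (hρ : ρ ∈ Ioo (0 : ℝ) 1) (hγ : 0 < γ) (hl : 0 < lam) :
    IntegrableOn (spectralDensity ρ γ lam) (Ioi 0) ∧
      ∫ r in Ioi (0 : ℝ), spectralDensity ρ γ lam r = 1 := by
  have hs : ∀ n : ℕ, (0 : ℝ) < n + 1 := fun n => by positivity
  have hst := fun n : ℕ => stieltjes hρ hγ hl (hs n)
  refine integrable_and_integral_eq_of_monotone_tendsto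
    (F := fun n r => (n + 1) * (spectralDensity ρ γ lam r / (r + (n + 1))))
    (fun n => (hst n).1.const_mul _) ?_ ?_ ?_ ?_
  · intro n
    filter_upwards [ae_restrict_mem measurableSet_Ioi] with r hr
    have := spectralDensity_nonneg hρ hγ hl hr
    have : 0 < r := hr
    positivity
  · filter_upwards [ae_restrict_mem measurableSet_Ioi] with r hr n m hnm
    have h0 := spectralDensity_nonneg hρ hγ hl hr
    have hr' : 0 < r := hr
    have hnm' : (n : ℝ) ≤ m := by exact_mod_cast hnm
    simp only
    rw [← mul_div_assoc, ← mul_div_assoc, div_le_div_iff₀ (by positivity) (by positivity)]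
    nlinarith [mul_nonneg (mul_nonneg h0 hr'.le) (sub_nonneg.2 hnm')]
  · filter_upwards [ae_restrict_mem measurableSet_Ioi] with r hr
    have hr' : 0 < r := hr
    have h1 : Tendsto (fun n : ℕ => (1 + r * ((n : ℝ) + 1)⁻¹)⁻¹ * spectralDensity ρ γ lam r) atTop
        (𝓝 ((1 + r * 0)⁻¹ * spectralDensity ρ γ lam r)) := by
      have := (tendsto_one_div_add_atTop_nhds_zero_nat (𝕜 := ℝ))
      simp only [one_div] at this
      exact (((this.const_mul r).const_add 1).inv₀ (by simp)).mul_const _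
    simp only [mul_zero, add_zero, inv_one, one_mul] at h1
    refine h1.congr fun n => ?_
    have := hs n
    field_simp
    ring
  · have h1 : Tendsto (fun n : ℕ => (1 + lam * ((n : ℝ) + 1)⁻¹ +
        lam * γ * (((n : ℝ) + 1)⁻¹) ^ (1 - ρ))⁻¹) atTop
        (𝓝 ((1 + lam * 0 + lam * γ * 0 ^ (1 - ρ))⁻¹)) := by
      have := (tendsto_one_div_add_atTop_nhds_zero_nat (𝕜 := ℝ))
      simp only [one_div] at this
      have h0 : (0 : ℝ) ^ (1 - ρ) = 0 := Real.zero_rpow (by linarith [hρ.2])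
      refine (((this.const_mul lam).const_add 1).add
        ((this.rpow_const (Or.inr (by linarith [hρ.2]))).const_mul (lam * γ))).inv₀ ?_
      simp [h0]
    rw [Real.zero_rpow (by linarith [hρ.2])] at h1
    simp only [mul_zero, add_zero, inv_one] at h1
    refine h1.congr fun n => ?_
    rw [integral_const_mul, (hst n).2, symbol]
    have hn := hs n
    have e : (((n : ℝ) + 1)⁻¹) ^ (1 - ρ) = ((n : ℝ) + 1) ^ ρ / (n + 1) := by
      rw [Real.inv_rpow hn.le, ← Real.rpow_neg hn.le, neg_sub, Real.rpow_sub_one hn.ne']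
    rw [e]
    have := Real.rpow_pos_of_pos hn ρ
    field_simp

/-- As `s → 0`, `1 / (r + s)` increases to `1 / r` while the symbol tends to `1 / lam`. -/
theorem spectralDensity_div_integrable (hρ : ρ ∈ Ioo (0 : ℝ) 1) (hγ : 0 < γ) (hl : 0 < lam) :
    IntegrableOn (fun r => spectralDensity ρ γ lam r / r) (Ioi 0) ∧
      ∫ r in Ioi (0 : ℝ), spectralDensity ρ γ lam r / r = lam⁻¹ := by
  have hs : ∀ n : ℕ, (0 : ℝ) < ((n : ℝ) + 1)⁻¹ := fun n => by positivity
  have hst := fun n : ℕ => stieltjes hρ hγ hl (hs n)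
  have h0 : Tendsto (fun n : ℕ => ((n : ℝ) + 1)⁻¹) atTop (𝓝 0) := by
    simpa only [one_div] using (tendsto_one_div_add_atTop_nhds_zero_nat (𝕜 := ℝ))
  refine integrable_and_integral_eq_of_monotone_tendsto
    (F := fun n r => (spectralDensity ρ γ lam r / (r + ((n : ℝ) + 1)⁻¹)))
    (fun n => (hst n).1) ?_ ?_ ?_ ?_
  · intro n
    filter_upwards [ae_restrict_mem measurableSet_Ioi] with r hr
    have := spectralDensity_nonneg hρ hγ hl hr
    have : 0 < r := hr
    positivity
  · filter_upwards [ae_restrict_mem measurableSet_Ioi] with r hr n m hnm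
    have h0 := spectralDensity_nonneg hρ hγ hl hr
    have hr' : 0 < r := hr
    have hnm' : (n : ℝ) ≤ m := by exact_mod_cast hnm
    simp only
    gcongr
  · filter_upwards [ae_restrict_mem measurableSet_Ioi] with r hr
    have hr' : 0 < r := hr
    have := (tendsto_const_nhds (x := spectralDensity ρ γ lam r)).div (h0.const_add r)
      (by simpa using hr'.ne')
    rw [add_zero] at this
    exact this
  · have h1 : Tendsto (fun n : ℕ => (((n : ℝ) + 1)⁻¹ + lam +
        lam * γ * (((n : ℝ) + 1)⁻¹) ^ ρ)⁻¹) atTop (𝓝 ((0 + lam + lam * γ * 0 ^ ρ)⁻¹)) := by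
      refine ((h0.add_const lam).add
        ((h0.rpow_const (Or.inr hρ.1.le)).const_mul (lam * γ))).inv₀ ?_
      simp [Real.zero_rpow hρ.1.ne', hl.ne']
    rw [Real.zero_rpow hρ.1.ne', mul_zero, add_zero, zero_add] at h1
    exact h1.congr fun n => (hst n).2.symm

/-- The Laplace transform applied twice is the Stieltjes transform, by Fubini. -/
theorem laplace_of_weight {w : ℝ → ℝ} {s : ℝ} (hs : 0 < s)
    (hw : AEStronglyMeasurable w (volume.restrict (Ioi 0)))
    (hi : IntegrableOn (fun r => w r / (r + s)) (Ioi 0)) :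
    IntegrableOn (fun t => Real.exp (-(s * t)) * ∫ r in Ioi (0 : ℝ), Real.exp (-r * t) * w r)
      (Ioi 0) ∧
    ∫ t in Ioi (0 : ℝ), Real.exp (-(s * t)) * ∫ r in Ioi (0 : ℝ), Real.exp (-r * t) * w r =
      ∫ r in Ioi (0 : ℝ), w r / (r + s) := by
  have h := integrableOn_and_integral_of_weight (S := Ioi 0) measurableSet_Ioi (w := w)
    (E := fun r => (r + s)⁻¹) (e := fun r t => Real.exp (-(r + s) * t)) (by fun_prop) hw
    (fun r _ t _ => (Real.exp_pos _).le)
    (fun r hr => integrableOn_exp_mul_Ioi (by linarith [mem_Ioi.1 hr]) 0)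
    (fun r hr => by
      rw [integral_exp_mul_Ioi (by linarith [mem_Ioi.1 hr]) 0, mul_zero, Real.exp_zero,
        neg_div_neg_eq, one_div])
    (by simpa only [div_eq_inv_mul] using hi)
  have e : ∀ t, Real.exp (-(s * t)) * ∫ r in Ioi (0 : ℝ), Real.exp (-r * t) * w r =
      ∫ r in Ioi (0 : ℝ), Real.exp (-(r + s) * t) * w r := fun t => by
    rw [← integral_const_mul]
    congr 1 with r
    rw [← mul_assoc, ← Real.exp_add]
    congr 2
    ring
  simp only [e]
  simpa only [div_eq_inv_mul] using h

theorem primitive_of_weight {w : ℝ → ℝ} {t : ℝ} (ht : 0 ≤ t) (hw : IntegrableOn w (Ioi 0)) :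
    IntegrableOn (fun s => ∫ r in Ioi (0 : ℝ), Real.exp (-r * s) * (r * w r)) (Ioo 0 t) ∧
    ∫ s in (0 : ℝ)..t, ∫ r in Ioi (0 : ℝ), Real.exp (-r * s) * (r * w r) =
      (∫ r in Ioi (0 : ℝ), w r) - ∫ r in Ioi (0 : ℝ), Real.exp (-r * t) * w r := by
  have hexp : IntegrableOn (fun r => Real.exp (-r * t) * w r) (Ioi 0) := by
    refine Integrable.bdd_mul (c := 1) hw (by fun_prop) ?_
    filter_upwards [ae_restrict_mem measurableSet_Ioi] with r hr
    rw [Real.norm_of_nonneg (Real.exp_pos _).le]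
    exact Real.exp_le_one_iff.2 (by nlinarith [mem_Ioi.1 hr])
  have h := integrableOn_and_integral_of_weight (S := Ioo 0 t) measurableSet_Ioo (w := w)
    (E := fun r => 1 - Real.exp (-r * t)) (e := fun r s => Real.exp (-r * s) * r) (by fun_prop)
    hw.1 (fun r hr s _ => mul_nonneg (Real.exp_pos _).le (le_of_lt hr))
    (fun r hr => (Continuous.integrableOn_Icc (by fun_prop)).mono_set Ioo_subset_Icc_self)
    (fun r hr => by
      rw [← integral_Ioc_eq_integral_Ioo, ← intervalIntegral.integral_of_le ht]
      have := intervalIntegral.integral_eq_sub_of_hasDerivAt (a := 0) (b := t)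
        (f := fun s => -Real.exp (-r * s)) (f' := fun s => Real.exp (-r * s) * r)
        (fun s _ => by
          have := ((hasDerivAt_id s).const_mul (-r)).exp.fun_neg
          simpa using this)
        (Continuous.intervalIntegrable (by fun_prop) _ _)
      rw [this]
      simp
      ring)
    (by
      simp only [sub_mul, one_mul]
      exact hw.sub hexp)
  simp only [mul_assoc] at h
  refine ⟨h.1, ?_⟩
  rw [intervalIntegral.integral_of_le ht, integral_Ioc_eq_integral_Ioo, h.2]
  simp only [sub_mul, one_mul]
  exact integral_sub hw hexp

/-- The last bound is `x exp (-x) ≤ 1` with `x = r t`: a time derivative of the Laplace integral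
costs a factor `1 / t`. -/
theorem laplaceIntegral_bounds {w : ℝ → ℝ} {t : ℝ} (ht : 0 ≤ t) (hw : IntegrableOn w (Ioi 0))
    (hw0 : ∀ r ∈ Ioi (0 : ℝ), 0 ≤ w r) :
    0 ≤ ∫ r in Ioi (0 : ℝ), Real.exp (-r * t) * w r ∧
    ∫ r in Ioi (0 : ℝ), Real.exp (-r * t) * w r ≤ ∫ r in Ioi (0 : ℝ), w r ∧
    t * ∫ r in Ioi (0 : ℝ), Real.exp (-r * t) * (r * w r) ≤ ∫ r in Ioi (0 : ℝ), w r := by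
  refine ⟨setIntegral_nonneg measurableSet_Ioi fun r hr =>
    mul_nonneg (Real.exp_pos _).le (hw0 r hr), ?_, ?_⟩
  · refine integral_mono_of_nonneg ?_ hw ?_
    · filter_upwards [ae_restrict_mem measurableSet_Ioi] with r hr
      exact mul_nonneg (Real.exp_pos _).le (hw0 r hr)
    · filter_upwards [ae_restrict_mem measurableSet_Ioi] with r hr
      refine mul_le_of_le_one_left (hw0 r hr) (Real.exp_le_one_iff.2 ?_)
      nlinarith [mem_Ioi.1 hr]
  · rw [← integral_const_mul]
    refine integral_mono_of_nonneg ?_ hw ?_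
    · filter_upwards [ae_restrict_mem measurableSet_Ioi] with r hr
      exact mul_nonneg ht (mul_nonneg (Real.exp_pos _).le (mul_nonneg (le_of_lt hr) (hw0 r hr)))
    · filter_upwards [ae_restrict_mem measurableSet_Ioi] with r hr
      have h1 : r * t + 1 ≤ Real.exp (r * t) := Real.add_one_le_exp _
      have h2 : r * t * Real.exp (-(r * t)) ≤ 1 := by
        rw [Real.exp_neg, ← div_eq_mul_inv, div_le_one (Real.exp_pos _)]
        linarith
      calc t * (Real.exp (-r * t) * (r * w r)) = (r * t * Real.exp (-(r * t))) * w r := by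
            rw [neg_mul]; ring
        _ ≤ w r := mul_le_of_le_one_left (hw0 r hr) h2

theorem continuousOn_laplaceIntegral {w : ℝ → ℝ} (hw : IntegrableOn w (Ioi 0)) :
    ContinuousOn (fun t => ∫ r in Ioi (0 : ℝ), Real.exp (-r * t) * w r) (Ici 0) := by
  refine continuousOn_of_dominated (bound := fun r => ‖w r‖) (fun t _ => ?_) (fun t ht => ?_)
    hw.norm (Eventually.of_forall fun r => by fun_prop)
  · exact (by fun_prop : Continuous fun r => Real.exp (-r * t)).aestronglyMeasurable.mul hw.1
  · filter_upwards [ae_restrict_mem measurableSet_Ioi] with r hr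
    rw [norm_mul, Real.norm_of_nonneg (Real.exp_pos _).le]
    refine mul_le_of_le_one_left (norm_nonneg _) (Real.exp_le_one_iff.2 ?_)
    nlinarith [mem_Ioi.1 hr, mem_Ici.1 ht]

theorem kernelB_bounds (hρ : ρ ∈ Ioo (0 : ℝ) 1) (hγ : 0 < γ) (hl : 0 < lam) {t : ℝ}
    (ht : 0 ≤ t) : 0 ≤ kernelB ρ γ lam t ∧ kernelB ρ γ lam t ≤ 1 := by
  have h := spectralDensity_integrable hρ hγ hl
  have hb := laplaceIntegral_bounds ht h.1 fun r hr => spectralDensity_nonneg hρ hγ hl hr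
  rw [h.2] at hb
  rw [kernelB_eq]
  exact ⟨hb.1, hb.2.1⟩

theorem kernelD_bounds (hρ : ρ ∈ Ioo (0 : ℝ) 1) (hγ : 0 < γ) (hl : 0 < lam) {t : ℝ}
    (ht : 0 ≤ t) : 0 ≤ kernelD ρ γ lam t ∧ t * kernelD ρ γ lam t ≤ 1 := by
  have h := spectralDensity_integrable hρ hγ hl
  have hb := laplaceIntegral_bounds ht h.1 fun r hr => spectralDensity_nonneg hρ hγ hl hr
  rw [h.2] at hb
  exact ⟨setIntegral_nonneg measurableSet_Ioi fun r hr => mul_nonneg (Real.exp_pos _).le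
    (mul_nonneg (le_of_lt hr) (spectralDensity_nonneg hρ hγ hl hr)), hb.2.2⟩

/-- The weight `lam * σ r / r` of `kernelA`, where `σ` is the spectral density, has mass 1, and
multiplying it by `r` gives the weight of `lam * kernelB`; hence the decay of the latter uniformly
in `lam`. -/
theorem kernelA_bounds (hρ : ρ ∈ Ioo (0 : ℝ) 1) (hγ : 0 < γ) (hl : 0 < lam) {t : ℝ}
    (ht : 0 ≤ t) : 0 ≤ kernelA ρ γ lam t ∧ kernelA ρ γ lam t ≤ 1 ∧
      t * (lam * kernelB ρ γ lam t) ≤ 1 := by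
  have h := spectralDensity_div_integrable hρ hγ hl
  have hb := laplaceIntegral_bounds ht (h.1.const_mul lam) fun r hr => mul_nonneg hl.le
    (div_nonneg (spectralDensity_nonneg hρ hγ hl hr) (le_of_lt hr))
  rw [integral_const_mul, h.2, mul_inv_cancel₀ hl.ne'] at hb
  rw [kernelA_eq]
  refine ⟨hb.1, hb.2.1, ?_⟩
  convert! hb.2.2 using 2
  rw [kernelB_eq, ← integral_const_mul]
  refine setIntegral_congr_fun measurableSet_Ioi fun r hr => ?_
  have : r ≠ 0 := ne_of_gt hr
  field_simp

theorem continuousOn_kernelA (hρ : ρ ∈ Ioo (0 : ℝ) 1) (hγ : 0 < γ) (hl : 0 < lam) :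
    ContinuousOn (kernelA ρ γ lam) (Ici 0) := by
  have := continuousOn_laplaceIntegral ((spectralDensity_div_integrable hρ hγ hl).1.const_mul lam)
  simpa only [← kernelA_eq] using this

theorem continuousOn_kernelB (hρ : ρ ∈ Ioo (0 : ℝ) 1) (hγ : 0 < γ) (hl : 0 < lam) :
    ContinuousOn (kernelB ρ γ lam) (Ici 0) := by
  have := continuousOn_laplaceIntegral (spectralDensity_integrable hρ hγ hl).1
  simpa only [← kernelB_eq] using this

theorem integral_kernelD (hρ : ρ ∈ Ioo (0 : ℝ) 1) (hγ : 0 < γ) (hl : 0 < lam) {t : ℝ}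
    (ht : 0 ≤ t) : IntegrableOn (kernelD ρ γ lam) (Ioo 0 t) ∧
      ∫ s in (0 : ℝ)..t, kernelD ρ γ lam s = 1 - kernelB ρ γ lam t := by
  have h := spectralDensity_integrable hρ hγ hl
  have := primitive_of_weight ht h.1
  rw [h.2, ← kernelB_eq] at this
  exact this

theorem integral_kernelB (hρ : ρ ∈ Ioo (0 : ℝ) 1) (hγ : 0 < γ) (hl : 0 < lam) {t : ℝ}
    (ht : 0 ≤ t) : lam * ∫ s in (0 : ℝ)..t, kernelB ρ γ lam s = 1 - kernelA ρ γ lam t := by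
  have h := spectralDensity_div_integrable hρ hγ hl
  have := (primitive_of_weight ht (h.1.const_mul lam)).2
  rw [integral_const_mul, h.2, mul_inv_cancel₀ hl.ne', ← kernelA_eq] at this
  rw [← this, ← intervalIntegral.integral_const_mul]
  congr 1 with s
  rw [kernelB_eq, ← integral_const_mul]
  refine setIntegral_congr_fun measurableSet_Ioi fun r hr => ?_
  have : r ≠ 0 := ne_of_gt hr
  field_simp

theorem laplace_kernelD (hρ : ρ ∈ Ioo (0 : ℝ) 1) (hγ : 0 < γ) (hl : 0 < lam) {s : ℝ}
    (hs : 0 < s) : IntegrableOn (fun t => Real.exp (-(s * t)) * kernelD ρ γ lam t) (Ioi 0) ∧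
      ∫ t in Ioi (0 : ℝ), Real.exp (-(s * t)) * kernelD ρ γ lam t =
        1 - s * symbol ρ γ lam s := by
  have h := spectralDensity_integrable hρ hγ hl
  have hS := stieltjes hρ hγ hl hs
  have e : ∀ r ∈ Ioi (0 : ℝ), spectralDensity ρ γ lam r -
      s * (spectralDensity ρ γ lam r / (r + s)) = r * spectralDensity ρ γ lam r / (r + s) := by
    intro r hr
    have : r + s ≠ 0 := by have := mem_Ioi.1 hr; positivity
    field_simp
    ring
  have hi : IntegrableOn (fun r => r * spectralDensity ρ γ lam r / (r + s)) (Ioi 0) :=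
    (h.1.sub (hS.1.const_mul s)).congr_fun e measurableSet_Ioi
  have hL := laplace_of_weight hs (continuous_id.aestronglyMeasurable.mul h.1.1) hi
  refine ⟨hL.1, hL.2.trans ?_⟩
  simp only [Pi.mul_apply, id]
  rw [← setIntegral_congr_fun measurableSet_Ioi e, integral_sub h.1 (hS.1.const_mul s),
    integral_const_mul, hS.2, h.2]

theorem gamma_one_sub_pos (hρ : ρ ∈ Ioo (0 : ℝ) 1) : 0 < Real.Gamma (1 - ρ) :=
  Real.Gamma_pos_of_pos (by linarith [hρ.2])

theorem volterraKernel_nonneg (hρ : ρ ∈ Ioo (0 : ℝ) 1) (hγ : 0 < γ) (hl : 0 < lam) {t : ℝ}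
    (ht : 0 < t) : 0 ≤ volterraKernel ρ γ lam t := by
  have := gamma_one_sub_pos hρ
  have := Real.rpow_pos_of_pos ht (-ρ)
  unfold volterraKernel
  positivity

theorem laplace_volterraKernel (hρ : ρ ∈ Ioo (0 : ℝ) 1) {s : ℝ} (hs : 0 < s) :
    IntegrableOn (fun t => Real.exp (-(s * t)) * volterraKernel ρ γ lam t) (Ioi 0) ∧
      ∫ t in Ioi (0 : ℝ), Real.exp (-(s * t)) * volterraKernel ρ γ lam t =
        lam * (1 + γ * s ^ ρ) / s := by
  have hG := gamma_one_sub_pos hρ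
  have i1 : IntegrableOn (fun t : ℝ => Real.exp (-s * t)) (Ioi 0) :=
    integrableOn_exp_mul_Ioi (by linarith) 0
  have i2 : IntegrableOn (fun t : ℝ => t ^ ((1 - ρ) - 1) * Real.exp (-(s * t))) (Ioi 0) := by
    have := integrableOn_rpow_mul_exp_neg_mul_rpow (s := (1 - ρ) - 1) (p := 1)
      (by linarith [hρ.2]) one_pos hs
    simpa using this
  have v1 : ∫ t in Ioi (0 : ℝ), Real.exp (-s * t) = s⁻¹ := by
    rw [integral_exp_mul_Ioi (by linarith) 0]
    simp
  have v2 := Real.integral_rpow_mul_exp_neg_mul_Ioi (a := 1 - ρ) (by linarith [hρ.2]) hs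
  have e : ∀ t : ℝ, lam * Real.exp (-s * t) + lam * γ * (1 / Real.Gamma (1 - ρ)) *
      (t ^ ((1 - ρ) - 1) * Real.exp (-(s * t))) =
      Real.exp (-(s * t)) * volterraKernel ρ γ lam t := fun t => by
    rw [show (1 - ρ) - 1 = -ρ by ring, neg_mul]
    unfold volterraKernel
    ring
  constructor
  · exact (IntegrableOn.add (i1.const_mul lam) (i2.const_mul _)).congr_fun (fun t _ => e t) measurableSet_Ioi
  · simp only [← e]
    rw [integral_add (i1.const_mul lam) (i2.const_mul _), integral_const_mul, integral_const_mul,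
      v1, v2, one_div s, Real.inv_rpow hs.le, ← Real.rpow_neg hs.le, neg_sub,
      Real.rpow_sub_one hs.ne']
    field_simp

/-- On the transform side, `1 + K̂ = 1 / (s * symbol s)` and `D̂ = 1 - s * symbol s`, so `D̂ (1 +
K̂) = K̂`. -/
theorem kernelD_resolvent (hρ : ρ ∈ Ioo (0 : ℝ) 1) (hγ : 0 < γ) (hl : 0 < lam) :
    ∀ᵐ t ∂volume.restrict (Ioi 0),
      kernelD ρ γ lam t + causalConv (volterraKernel ρ γ lam) (kernelD ρ γ lam) t =
        volterraKernel ρ γ lam t := by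
  refine resolvent_of_laplace (fun t ht => volterraKernel_nonneg hρ hγ hl ht)
    (fun t ht => (kernelD_bounds hρ hγ hl (le_of_lt ht)).1)
    (fun s hs => (laplace_volterraKernel hρ hs).1) (fun s hs => (laplace_kernelD hρ hγ hl hs).1)
    fun s hs => ?_
  rw [(laplace_volterraKernel hρ hs).2, (laplace_kernelD hρ hγ hl hs).2, symbol]
  have := Real.rpow_pos_of_pos hs ρ
  have : s + lam + lam * γ * s ^ ρ ≠ 0 := by positivity
  field_simp
  ring

theorem integrableOn_volterraKernel (hρ : ρ ∈ Ioo (0 : ℝ) 1) {T : ℝ} (hT : 0 < T) :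
    IntegrableOn (volterraKernel ρ γ lam) (Ioo 0 T) := by
  have h1 : IntegrableOn (fun t : ℝ => t ^ (-ρ)) (Ioo 0 T) :=
    (intervalIntegral.integrableOn_Ioo_rpow_iff hT).2 (by linarith [hρ.2])
  have h2 : IntegrableOn (fun _ : ℝ => (1 : ℝ)) (Ioo 0 T) := integrableOn_const (by simp)
  exact (h2.add ((h1.const_mul _).const_mul γ)).const_mul lam

/-- The convolution term of the resolvent identity is nonnegative. This bounds `kernelD` by `lam`
times a singularity of order `ρ < 1`, which is the endpoint needed for interpolation. -/
theorem kernelD_le_volterraKernel (hρ : ρ ∈ Ioo (0 : ℝ) 1) (hγ : 0 < γ) (hl : 0 < lam) :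
    ∀ᵐ t ∂volume.restrict (Ioi 0), kernelD ρ γ lam t ≤ volterraKernel ρ γ lam t := by
  filter_upwards [kernelD_resolvent hρ hγ hl, ae_restrict_mem measurableSet_Ioi] with t ht h0
  have h0' : (0 : ℝ) < t := h0
  have : 0 ≤ causalConv (volterraKernel ρ γ lam) (kernelD ρ γ lam) t := by
    refine intervalIntegral.integral_nonneg_of_ae_restrict h0'.le ?_
    rw [← Measure.restrict_congr_set Ioo_ae_eq_Icc]
    filter_upwards [ae_restrict_mem measurableSet_Ioo] with x hx
    exact mul_nonneg (volterraKernel_nonneg hρ hγ hl hx.1)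
      (kernelD_bounds hρ hγ hl (sub_pos.2 hx.2).le).1
  linarith

end Kernels

/-! ### Operators diagonal in the eigenbasis. -/

section Diagonal

variable {𝕜 : Type*} [RCLike 𝕜] {H : Type*} [NormedAddCommGroup H] [InnerProductSpace 𝕜 H]

theorem hilbertBasis_ext (v : HilbertBasis ℕ 𝕜 H) {x y : H}
    (h : ∀ k, inner 𝕜 (v k) x = inner 𝕜 (v k) y) : x = y := by
  apply v.repr.injective
  ext k
  simpa only [v.repr_apply_apply] using h k

theorem hasSum_norm_inner_sq (v : HilbertBasis ℕ 𝕜 H) (x : H) :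
    HasSum (fun k => ‖inner 𝕜 (v k) x‖ ^ 2) (‖x‖ ^ 2) := by
  have h := lp.hasSum_norm (p := 2) (by norm_num) (v.repr x)
  simp only [v.repr_apply_apply, ENNReal.toReal_ofNat, Real.rpow_ofNat,
    LinearIsometryEquiv.norm_map] at h
  exact h

theorem exists_inner_eq (v : HilbertBasis ℕ 𝕜 H) {a : ℕ → 𝕜} (ha : Summable fun k => ‖a k‖ ^ 2) :
    ∃ x : H, ∀ k, inner 𝕜 (v k) x = a k := by
  have hm : Memℓp a 2 := by
    rw [memℓp_gen_iff (by norm_num)]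
    simpa using ha
  refine ⟨v.repr.symm ⟨a, hm⟩, fun k => ?_⟩
  rw [← v.repr_apply_apply, LinearIsometryEquiv.apply_symm_apply]

theorem norm_le_of_inner_le (v : HilbertBasis ℕ 𝕜 H) {x y : H} {c : ℝ} (hc : 0 ≤ c)
    (h : ∀ k, ‖inner 𝕜 (v k) y‖ ≤ c * ‖inner 𝕜 (v k) x‖) : ‖y‖ ≤ c * ‖x‖ := by
  have h1 := hasSum_norm_inner_sq v y
  have h2 := (hasSum_norm_inner_sq v x).mul_left (c ^ 2)
  have h3 := hasSum_le (fun k => by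
    have := pow_le_pow_left₀ (norm_nonneg _) (h k) 2
    rwa [mul_pow] at this) h1 h2
  rw [← mul_pow] at h3
  exact le_of_sq_le_sq h3 (by positivity)

/-- The operator with matrix `diag(m 0, m 1, …)` in the basis `v`. -/
def diag (v : HilbertBasis ℕ 𝕜 H) (m : ℕ → ℝ) (x : H) : H :=
  ∑' k, (m k • inner 𝕜 (v k) x) • v k

variable (v : HilbertBasis ℕ 𝕜 H)

theorem exists_diag {m : ℕ → ℝ} {c : ℝ} (hm : ∀ k, |m k| ≤ c) (x : H) :
    ∃ y, ∀ k, inner 𝕜 (v k) y = m k • inner 𝕜 (v k) x := by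
  refine exists_inner_eq v (((hasSum_norm_inner_sq v x).summable.mul_left (c ^ 2)).of_nonneg_of_le
    (fun k => sq_nonneg _) fun k => ?_)
  rw [norm_smul, Real.norm_eq_abs, mul_pow]
  gcongr
  exact hm k

theorem hasSum_diag {m : ℕ → ℝ} {c : ℝ} (hm : ∀ k, |m k| ≤ c) (x : H) :
    HasSum (fun k => (m k • inner 𝕜 (v k) x) • v k) (diag v m x) := by
  obtain ⟨y, hy⟩ := exists_diag v hm x
  have := v.hasSum_repr y
  simp only [v.repr_apply_apply, hy] at this
  exact this.summable.hasSum

theorem inner_diag {m : ℕ → ℝ} {c : ℝ} (hm : ∀ k, |m k| ≤ c) (x : H) (k : ℕ) :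
    inner 𝕜 (v k) (diag v m x) = m k • inner 𝕜 (v k) x := by
  obtain ⟨y, hy⟩ := exists_diag v hm x
  have := v.hasSum_repr y
  simp only [v.repr_apply_apply, hy] at this
  rw [diag, this.tsum_eq, hy]

theorem norm_diag_le {m : ℕ → ℝ} {c : ℝ} (hm : ∀ k, |m k| ≤ c) (x : H) :
    ‖diag v m x‖ ≤ c * ‖x‖ := by
  refine norm_le_of_inner_le v ((abs_nonneg _).trans (hm 0)) fun k => ?_
  rw [inner_diag v hm, norm_smul, Real.norm_eq_abs]
  exact mul_le_mul_of_nonneg_right (hm k) (norm_nonneg _)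

theorem diag_sub {m : ℕ → ℝ} {c : ℝ} (hm : ∀ k, |m k| ≤ c) (x y : H) :
    diag v m (x - y) = diag v m x - diag v m y := by
  refine hilbertBasis_ext v fun k => ?_
  rw [inner_diag v hm, inner_sub_right, inner_sub_right, inner_diag v hm, inner_diag v hm,
    smul_sub]

theorem continuous_diag {m : ℕ → ℝ} {c : ℝ} (hm : ∀ k, |m k| ≤ c) : Continuous (diag v m) := by
  have : LipschitzWith (Real.toNNReal c) (diag v m) := by
    refine LipschitzWith.of_dist_le_mul fun x y => ?_
    rw [dist_eq_norm, dist_eq_norm, ← diag_sub v hm,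
      Real.coe_toNNReal c ((abs_nonneg _).trans (hm 0))]
    exact norm_diag_le v hm _
  exact this.continuous

/-- The right-hand side depends on the multiplier only through `c`, which makes the convergence
uniform over a family of multipliers. -/
theorem diag_eq_sum_add {m : ℕ → ℝ} {c : ℝ} (hm : ∀ k, |m k| ≤ c) (x : H) (s : Finset ℕ) :
    ‖diag v m x - ∑ k ∈ s, (m k • inner 𝕜 (v k) x) • v k‖ ≤
      c * ‖x - ∑ k ∈ s, inner 𝕜 (v k) x • v k‖ := by
  refine norm_le_of_inner_le v ((abs_nonneg _).trans (hm 0)) fun k => ?_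
  have key : ∀ a : ℕ → 𝕜, inner 𝕜 (v k) (∑ i ∈ s, a i • v i) = if k ∈ s then a k else 0 := by
    intro a
    classical
    simp only [inner_sum, inner_smul_right, orthonormal_iff_ite.1 v.orthonormal k]
    simp
  rw [inner_sub_right, inner_sub_right, key, key, inner_diag v hm]
  split_ifs
  · simp
  · rw [sub_zero, sub_zero, norm_smul, Real.norm_eq_abs]
    exact mul_le_mul_of_nonneg_right (hm k) (norm_nonneg _)

theorem continuousOn_diag {m : ℝ → ℕ → ℝ} {S : Set ℝ} {c : ℝ} (hm : ∀ t ∈ S, ∀ k, |m t k| ≤ c)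
    (hc : ∀ k, ContinuousOn (fun t => m t k) S) (x : H) :
    ContinuousOn (fun t => diag v (m t) x) S := by
  have hx : Tendsto (fun s : Finset ℕ => |c| * ‖x - ∑ k ∈ s, inner 𝕜 (v k) x • v k‖) atTop
      (𝓝 0) := by
    have h := v.hasSum_repr x
    simp only [v.repr_apply_apply] at h
    have h2 : Tendsto (fun s : Finset ℕ => x - ∑ k ∈ s, inner 𝕜 (v k) x • v k) atTop
      (𝓝 (x - x)) := tendsto_const_nhds.sub h
    simpa using h2.norm.const_mul |c|
  have hu : TendstoUniformlyOn (fun (s : Finset ℕ) t => ∑ k ∈ s, (m t k • inner 𝕜 (v k) x) • v k)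
      (fun t => diag v (m t) x) atTop S := by
    rw [Metric.tendstoUniformlyOn_iff]
    intro ε hε
    filter_upwards [hx.eventually (gt_mem_nhds hε)] with s hs t ht
    rw [dist_eq_norm]
    refine lt_of_le_of_lt ((diag_eq_sum_add v (hm t ht) x s).trans ?_) hs
    exact mul_le_mul_of_nonneg_right (le_abs_self c) (norm_nonneg _)
  refine hu.continuousOn (Frequently.of_forall fun s => ?_)
  refine continuousOn_finsetSum _ fun k _ => ?_
  exact ((hc k).smul continuousOn_const).smul continuousOn_const

end Diagonal

/-! ### Convolution with a diagonal operator-valued kernel that has an integrable majorant. -/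

section DiagonalConvolution

variable {𝕜 : Type*} [RCLike 𝕜] {H : Type*} [NormedAddCommGroup H] [InnerProductSpace 𝕜 H]
  (v : HilbertBasis ℕ 𝕜 H)

/-- The convolution of an operator-valued function, diagonal in the basis `v`, with an
`H`-valued function. -/
def diagConv [NormedSpace ℝ H] (m : ℝ → ℕ → ℝ) (Φ : ℝ → H) (t : ℝ) : H :=
  ∫ s in (0 : ℝ)..t, diag v (m s) (Φ (t - s))

variable {v} {m : ℝ → ℕ → ℝ} {κ : ℝ → ℝ} {Φ : ℝ → H} {T M : ℝ}

theorem aestronglyMeasurable_diag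
    (hm : ∀ᵐ s ∂volume.restrict (Ioo 0 T), ∀ k, |m s k| ≤ κ s)
    (hmeas : ∀ k, AEStronglyMeasurable (fun s => m s k) (volume.restrict (Ioo 0 T)))
    {Ψ : ℝ → H} (hΨ : Continuous Ψ) :
    AEStronglyMeasurable (fun s => diag v (m s) (Ψ s)) (volume.restrict (Ioo 0 T)) := by
  refine aestronglyMeasurable_of_tendsto_ae atTop
    (f := fun (N : ℕ) s => ∑ k ∈ Finset.range N, (m s k • inner 𝕜 (v k) (Ψ s)) • v k)
    (fun N => ?_) ?_
  · refine Finset.aestronglyMeasurable_fun_sum _ fun k _ => ?_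
    have : Continuous fun s => inner 𝕜 (v k) (Ψ s) := continuous_const.inner hΨ
    exact ((hmeas k).smul this.aestronglyMeasurable).smul_const _
  · filter_upwards [hm] with s hs
    exact (hasSum_diag v hs (Ψ s)).tendsto_sum_nat

theorem integrableOn_diag (hκ : IntegrableOn κ (Ioo 0 T))
    (hm : ∀ᵐ s ∂volume.restrict (Ioo 0 T), ∀ k, |m s k| ≤ κ s)
    (hmeas : ∀ k, AEStronglyMeasurable (fun s => m s k) (volume.restrict (Ioo 0 T)))
    {Ψ : ℝ → H} (hΨ : Continuous Ψ) (hM : ∀ s, ‖Ψ s‖ ≤ M) :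
    IntegrableOn (fun s => diag v (m s) (Ψ s)) (Ioo 0 T) := by
  refine Integrable.mono' (hκ.mul_const M) (aestronglyMeasurable_diag hm hmeas hΨ) ?_
  filter_upwards [hm] with s hs
  refine (norm_diag_le v hs _).trans ?_
  exact mul_le_mul_of_nonneg_left (hM s) ((abs_nonneg _).trans (hs 0))

variable [NormedSpace ℝ H]

theorem norm_diagConv_le (hκ : IntegrableOn κ (Ioo 0 T))
    (hm : ∀ᵐ s ∂volume.restrict (Ioo 0 T), ∀ k, |m s k| ≤ κ s)
    (hM : ∀ s, ‖Φ s‖ ≤ M) {t : ℝ} (ht : t ∈ Icc 0 T) :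
    ‖diagConv v m Φ t‖ ≤ (∫ s in Ioo 0 T, κ s) * M := by
  have hM0 : 0 ≤ M := (norm_nonneg _).trans (hM 0)
  have hsub : Ioo 0 t ⊆ Ioo 0 T := Ioo_subset_Ioo_right ht.2
  rw [diagConv, intervalIntegral.integral_of_le ht.1, integral_Ioc_eq_integral_Ioo,
    ← integral_mul_const]
  have hm' := ae_restrict_of_ae_restrict_of_subset hsub hm
  calc _ ≤ ∫ s in Ioo 0 t, κ s * M := by
        refine norm_integral_le_of_norm_le ((hκ.mono_set hsub).mul_const M) ?_
        filter_upwards [hm'] with s hs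
        refine (norm_diag_le v hs _).trans ?_
        exact mul_le_mul_of_nonneg_left (hM _) ((abs_nonneg _).trans (hs 0))
    _ ≤ _ := by
        refine setIntegral_mono_set (hκ.mul_const M) ?_ hsub.eventuallyLE
        filter_upwards [hm] with s hs
        exact mul_nonneg ((abs_nonneg _).trans (hs 0)) hM0

theorem inner_diagConv [CompleteSpace H] (hκ : IntegrableOn κ (Ioo 0 T))
    (hm : ∀ᵐ s ∂volume.restrict (Ioo 0 T), ∀ k, |m s k| ≤ κ s)
    (hmeas : ∀ k, AEStronglyMeasurable (fun s => m s k) (volume.restrict (Ioo 0 T)))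
    (hΦ : Continuous Φ) (hM : ∀ s, ‖Φ s‖ ≤ M) {t : ℝ} (ht : t ∈ Icc 0 T) (k : ℕ) :
    inner 𝕜 (v k) (diagConv v m Φ t) =
      causalConv (fun s => m s k) (fun s => inner 𝕜 (v k) (Φ s)) t := by
  have hsub : Ioo 0 t ⊆ Ioo 0 T := Ioo_subset_Ioo_right ht.2
  have hi : IntegrableOn (fun s => diag v (m s) (Φ (t - s))) (Ioo 0 t) :=
    (integrableOn_diag (Ψ := fun s => Φ (t - s)) hκ hm hmeas (by fun_prop) fun s => hM _).mono_set
      hsub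
  rw [diagConv, causalConv, intervalIntegral.integral_of_le ht.1,
    intervalIntegral.integral_of_le ht.1, integral_Ioc_eq_integral_Ioo,
    integral_Ioc_eq_integral_Ioo, ← innerSL_apply_apply 𝕜,
    ← ContinuousLinearMap.integral_comp_comm _ hi]
  refine integral_congr_ae ?_
  filter_upwards [ae_restrict_of_ae_restrict_of_subset hsub hm] with s hs
  rw [innerSL_apply_apply, inner_diag v hs]

/-- Dominated convergence after the variable endpoint is moved into an indicator function; the
integrand is continuous at `t₀` except for the single point `s = t₀`. -/
theorem continuousOn_diagConv (hκ : IntegrableOn κ (Ioo 0 T))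
    (hm : ∀ᵐ s ∂volume.restrict (Ioo 0 T), ∀ k, |m s k| ≤ κ s)
    (hmeas : ∀ k, AEStronglyMeasurable (fun s => m s k) (volume.restrict (Ioo 0 T)))
    (hΦ : Continuous Φ) (hM : ∀ s, ‖Φ s‖ ≤ M) :
    ContinuousOn (diagConv v m Φ) (Icc 0 T) := by
  have hc : Continuous fun t => ∫ s in Ioo 0 T, (Iio t).indicator
      (fun s => diag v (m s) (Φ (t - s))) s := by
    refine continuous_iff_continuousAt.2 fun t₀ => ?_
    refine continuousAt_of_dominated (bound := fun s => κ s * M)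
      (Eventually.of_forall fun t => ?_) (Eventually.of_forall fun t => ?_) (hκ.mul_const M) ?_
    · exact (aestronglyMeasurable_diag hm hmeas (by fun_prop)).indicator measurableSet_Iio
    · filter_upwards [hm] with s hs
      refine (norm_indicator_le_norm_self _ _).trans ((norm_diag_le v hs _).trans ?_)
      exact mul_le_mul_of_nonneg_left (hM _) ((abs_nonneg _).trans (hs 0))
    · filter_upwards [hm, ae_restrict_of_ae (Measure.ae_ne volume t₀)] with s hs hne
      rcases lt_or_gt_of_ne hne with h | h
      · have : (fun t => (Iio t).indicator (fun s => diag v (m s) (Φ (t - s))) s) =ᶠ[𝓝 t₀]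
            fun t => diag v (m s) (Φ (t - s)) := by
          filter_upwards [lt_mem_nhds h] with t ht
          exact indicator_of_mem (mem_Iio.2 ht) _
        refine ContinuousAt.congr ?_ this.symm
        exact ((continuous_diag v hs).comp (by fun_prop : Continuous fun t => Φ (t - s))).continuousAt
      · have : (fun t => (Iio t).indicator (fun s => diag v (m s) (Φ (t - s))) s) =ᶠ[𝓝 t₀]
            fun t => 0 := by
          filter_upwards [gt_mem_nhds h] with t ht
          exact indicator_of_notMem (fun h' => absurd (mem_Iio.1 h') (not_lt.2 (le_of_lt ht))) _
        exact continuousAt_const.congr this.symm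
  refine hc.continuousOn.congr fun t ht => ?_
  simp only
  rw [diagConv, intervalIntegral.integral_of_le ht.1, integral_Ioc_eq_integral_Ioo,
    setIntegral_indicator measurableSet_Iio]
  congr 2
  ext s
  simp only [mem_inter_iff, mem_Ioo, mem_Iio]
  constructor
  · exact fun h => ⟨⟨h.1, h.2.trans_le ht.2⟩, h.2⟩
  · exact fun h => ⟨h.1.1, h.2⟩

end DiagonalConvolution

/-! ### The domain of `A` and its fractional powers in coordinates. -/

section Domain

variable {𝕜 : Type*} [RCLike 𝕜] {H : Type*} [NormedAddCommGroup H] [InnerProductSpace 𝕜 H]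
  {v : HilbertBasis ℕ 𝕜 H} {lam : ℕ → ℝ}

theorem fracNorm_eq_norm {τ : ℝ} {x y : H} (hlam : ∀ k, 0 < lam k)
    (h : ∀ k, inner 𝕜 (v k) y = lam k ^ τ • inner 𝕜 (v k) x) : fracNorm v lam τ x = ‖y‖ := by
  rw [fracNorm, ← Real.sqrt_sq (norm_nonneg y), ← (hasSum_norm_inner_sq v y).tsum_eq]
  congr 2 with k
  rw [h k, norm_smul, Real.norm_of_nonneg (Real.rpow_nonneg (hlam k).le _), mul_pow, mul_comm 2 τ,
    Real.rpow_mul (hlam k).le, Real.rpow_two]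

theorem exists_fracPower {τ : ℝ} {x : H} (hlam : ∀ k, 0 < lam k) (hx : x ∈ fracDomain v lam τ) :
    ∃ y : H, ∀ k, inner 𝕜 (v k) y = lam k ^ τ • inner 𝕜 (v k) x := by
  refine exists_inner_eq v ((summable_congr fun k => ?_).1 hx)
  rw [norm_smul, Real.norm_of_nonneg (Real.rpow_nonneg (hlam k).le _), mul_pow, mul_comm 2 τ,
    Real.rpow_mul (hlam k).le, Real.rpow_two]

variable [CompleteSpace H] {A : H →ₗ.[𝕜] H}

theorem inner_app (hA : IsEigenSystem A v lam) {x : H} (hx : x ∈ A.domain) (k : ℕ) :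
    inner 𝕜 (v k) (app A x) = lam k • inner 𝕜 (v k) x := by
  obtain ⟨hk, he⟩ := hA.eigen k
  have hd := hA.selfAdjoint.dense_domain
  have hf := LinearPMap.adjoint_isFormalAdjoint (T := A) hd
  rw [LinearPMap.isSelfAdjoint_def.1 hA.selfAdjoint] at hf
  have := hf ⟨v k, hk⟩ ⟨x, hx⟩
  rw [app, dif_pos hx, ← this, he, inner_smul_left, RCLike.conj_ofReal,
    RCLike.real_smul_eq_coe_mul]

/-- By Parseval `y` represents the functional `z ↦ ⟪x, A z⟫`, so `x` lies in the domain of the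
adjoint, which is that of `A`. This is where self-adjointness, beyond symmetry, enters. -/
theorem app_eq_of_inner (hA : IsEigenSystem A v lam) {x y : H}
    (h : ∀ k, inner 𝕜 (v k) y = lam k • inner 𝕜 (v k) x) : x ∈ A.domain ∧ app A x = y := by
  have hx : x ∈ A.domain := by
    rw [← LinearPMap.isSelfAdjoint_def.1 hA.selfAdjoint]
    refine LinearPMap.mem_adjoint_domain_of_exists x ⟨y, fun z => ?_⟩
    have hz : A z = app A z := by rw [app, dif_pos z.2]
    rw [hz, ← v.tsum_inner_mul_inner, ← v.tsum_inner_mul_inner x]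
    congr 1 with k
    rw [inner_app hA z.2, ← inner_conj_symm, h k, ← inner_conj_symm x, RCLike.real_smul_eq_coe_mul,
      RCLike.real_smul_eq_coe_mul, map_mul, RCLike.conj_ofReal]
    ring
  refine ⟨hx, hilbertBasis_ext v fun k => ?_⟩
  rw [inner_app hA hx, h k]

theorem app_add (hA : IsEigenSystem A v lam) {x y : H} (hx : x ∈ A.domain) (hy : y ∈ A.domain) :
    app A (x + y) = app A x + app A y :=
  (app_eq_of_inner hA fun k => by
    rw [inner_add_right, inner_add_right, inner_app hA hx, inner_app hA hy, smul_add]).2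

theorem app_smul [NormedSpace ℝ H] (hA : IsEigenSystem A v lam) {x : H} (hx : x ∈ A.domain)
    (c : ℝ) : c • x ∈ A.domain ∧ app A (c • x) = c • app A x :=
  app_eq_of_inner hA fun k => by
    rw [inner_smul_right_eq_smul, inner_smul_right_eq_smul, inner_app hA hx, smul_comm]

theorem fracNorm_one_eq (hA : IsEigenSystem A v lam) {x : H} (hx : x ∈ A.domain) :
    fracNorm v lam 1 x = ‖app A x‖ :=
  fracNorm_eq_norm hA.pos fun k => by rw [inner_app hA hx, Real.rpow_one]

end Domain

/-! ### The scalar Volterra equation. -/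

section Volterra

variable {ρ γ lam T : ℝ}

theorem kernelD_resolvent_Ioo (hρ : ρ ∈ Ioo (0 : ℝ) 1) (hγ : 0 < γ) (hl : 0 < lam) :
    ∀ᵐ t ∂volume.restrict (Ioo 0 T), volterraKernel ρ γ lam t -
      causalConv (volterraKernel ρ γ lam) (kernelD ρ γ lam) t = kernelD ρ γ lam t := by
  filter_upwards [ae_restrict_of_ae_restrict_of_subset Ioo_subset_Ioi_self
    (kernelD_resolvent hρ hγ hl)] with t ht
  linarith

/-- If `p = c - D * c`, then `a * p = (a - a * D) * c`. -/
theorem causalConv_of_resolvent {E : Type*} [NormedAddCommGroup E] [NormedSpace ℝ E]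
    [CompleteSpace E] {a D : ℝ → ℝ} {c p : ℝ → E} (ha : IntegrableOn a (Ioo 0 T))
    (hD : IntegrableOn D (Ioo 0 T)) (hc : ContinuousOn c (Icc 0 T))
    (hp : ContinuousOn p (Icc 0 T)) (h : ∀ t ∈ Icc 0 T, p t = c t - causalConv D c t)
    {t : ℝ} (ht : t ∈ Icc 0 T) :
    causalConv a p t = causalConv (fun s => a s - causalConv a D s) c t := by
  rw [causalConv_sub_left ha (integrableOn_causalConv ha hD) hc ht, causalConv_assoc ha hD hc ht]
  have h1 : causalConv a (causalConv D c) t = causalConv a (fun s => c s - p s) t :=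
    causalConv_congr (fun s hs => by rw [h s hs]; abel) ht
  rw [h1, causalConv_sub ha hc hp ht]
  abel

/-- Convolving `K * y = -y` with `D` gives `D * (K * y) = -(D * y)`, while the resolvent identity
gives `D * (K * y) = K * y - D * y`. Hence `K * y = 0` and `y = 0`. -/
theorem eq_zero_of_volterra (hρ : ρ ∈ Ioo (0 : ℝ) 1) (hγ : 0 < γ) (hl : 0 < lam) (hT : 0 < T)
    {y : ℝ → ℝ} (hy : ContinuousOn y (Icc 0 T))
    (h : ∀ t ∈ Icc 0 T, y t + causalConv (volterraKernel ρ γ lam) y t = 0) :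
    ∀ t ∈ Icc 0 T, y t = 0 := by
  intro t ht
  set K := volterraKernel ρ γ lam
  set D := kernelD ρ γ lam
  have iK : IntegrableOn K (Ioo 0 T) := integrableOn_volterraKernel hρ hT
  have iD : IntegrableOn D (Ioo 0 T) := (integral_kernelD hρ hγ hl hT.le).1
  have h1 : causalConv D (causalConv K y) t = causalConv K y t - causalConv D y t := by
    rw [← causalConv_assoc iD iK hy ht, ← causalConv_sub_left iK iD hy ht]
    refine causalConv_congr_left ?_ ht
    filter_upwards [kernelD_resolvent_Ioo hρ hγ hl] with s hs
    rw [causalConv_comm]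
    linarith
  have h2 : causalConv D (causalConv K y) t = causalConv D (fun s => -y s) t :=
    causalConv_congr (fun s hs => by linarith [h s hs]) ht
  have h3 : causalConv D (fun s => -y s) t = -causalConv D y t := by
    simp only [causalConv, smul_neg, intervalIntegral.integral_neg]
  linarith [h t ht]

theorem causalConv_one {E : Type*} [NormedAddCommGroup E] [NormedSpace ℝ E] (h : ℝ → E) (t : ℝ) :
    causalConv (fun _ => 1) h t = ∫ s in (0 : ℝ)..t, h s := by
  simp only [causalConv, one_smul]
  rw [intervalIntegral.integral_comp_sub_left]
  simp

/-- With `h` the derivative of a solution, the two terms are `lam` times its increment and `lam γ`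
times its Caputo derivative. -/
theorem causalConv_volterraKernel {E : Type*} [NormedAddCommGroup E] [NormedSpace ℝ E]
    {h : ℝ → E} {t : ℝ} (ht : 0 ≤ t) (h1 : IntegrableOn h (Ioo 0 t))
    (h2 : IntegrableOn (fun ξ => (t - ξ) ^ (-ρ) • h ξ) (Ioo 0 t)) :
    causalConv (volterraKernel ρ γ lam) h t = lam • (∫ s in (0 : ℝ)..t, h s) +
      (lam * γ) • ((1 / Real.Gamma (1 - ρ)) • ∫ ξ in Ioo (0 : ℝ) t, (t - ξ) ^ (-ρ) • h ξ) := by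
  have e : causalConv (volterraKernel ρ γ lam) h t =
      ∫ ξ in (0 : ℝ)..t, volterraKernel ρ γ lam (t - ξ) • h ξ := by
    have := intervalIntegral.integral_comp_sub_left (a := 0) (b := t)
      (fun ξ => volterraKernel ρ γ lam (t - ξ) • h ξ) t
    simp only [sub_sub_cancel, sub_zero, sub_self] at this
    exact this
  rw [e, intervalIntegral.integral_of_le ht, intervalIntegral.integral_of_le ht,
    integral_Ioc_eq_integral_Ioo, integral_Ioc_eq_integral_Ioo, smul_smul, ← integral_smul,
    ← integral_smul]
  have e2 : ∀ ξ, volterraKernel ρ γ lam (t - ξ) • h ξ =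
      lam • h ξ + (lam * γ * (1 / Real.Gamma (1 - ρ))) • ((t - ξ) ^ (-ρ) • h ξ) := fun ξ => by
    rw [smul_smul, ← add_smul]
    congr 1
    unfold volterraKernel
    ring
  simp only [e2]
  exact integral_add (Integrable.smul lam h1)
    (Integrable.smul (lam * γ * (1 / Real.Gamma (1 - ρ))) h2)

end Volterra

/-! ### Uniqueness of the solution. -/

section Uniqueness

variable {𝕜 : Type*} [RCLike 𝕜] {H : Type*} [NormedAddCommGroup H] [InnerProductSpace 𝕜 H]
  [NormedSpace ℝ H]

/-- Multiplication by the bounded function `(T - ξ) ^ ρ` removes the Caputo weight. Integrability up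
to 0 allows a solution to be recovered from its derivative. -/
theorem integrableOn_deriv_of_caputoExists {ρ T : ℝ} (hρ : 0 < ρ) {u : ℝ → H}
    (h : CaputoExists ρ u T) : IntegrableOn (deriv u) (Ioo 0 T) := by
  have hm : AEStronglyMeasurable (fun ξ : ℝ => (T - ξ) ^ ρ) (volume.restrict (Ioo 0 T)) :=
    (by fun_prop : Measurable fun ξ : ℝ => (T - ξ) ^ ρ).aestronglyMeasurable
  have := Integrable.bdd_smul h.2 (T ^ ρ) hm (by
    filter_upwards [ae_restrict_mem measurableSet_Ioo] with ξ hξ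
    rw [Real.norm_of_nonneg (Real.rpow_nonneg (by linarith [hξ.2]) _)]
    exact Real.rpow_le_rpow (by linarith [hξ.2]) (by linarith [hξ.1]) hρ.le)
  refine IntegrableOn.congr_fun this (fun ξ hξ => ?_) measurableSet_Ioo
  have h0 : 0 < T - ξ := by linarith [hξ.2]
  simp only [Pi.smul_apply', smul_smul]
  rw [← Real.rpow_add h0, add_neg_cancel, Real.rpow_zero, one_smul]

variable {A : H →ₗ.[𝕜] H} {ρ γ T : ℝ} {f : ℝ → H} {φ : H} {u w : ℝ → H}

theorem IsForwardSolution.hasDerivAt (hu : IsForwardSolution A ρ γ T f φ u) {t : ℝ}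
    (ht : t ∈ Ioo 0 T) : HasDerivAt u (deriv u t) t ∧ derivWithin u (Icc 0 T) t = deriv u t := by
  have h1 := (hu.diff t (Ioo_subset_Ioc_self ht)).differentiableAt (Icc_mem_nhds ht.1 ht.2)
  exact ⟨h1.hasDerivAt, derivWithin_of_mem_nhds (Icc_mem_nhds ht.1 ht.2)⟩

variable [CompleteSpace H] {v : HilbertBasis ℕ 𝕜 H} {lam : ℕ → ℝ}

/-- A real functional that intertwines `A` with multiplication by `μ` reduces the difference of two
solutions to the scalar Volterra equation; real and imaginary parts of coordinates are of this kind.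
-/
theorem IsForwardSolution.functional_eq (hA : IsEigenSystem A v lam) (hρ : ρ ∈ Ioo (0 : ℝ) 1)
    (hγ : 0 < γ) (hT : 0 < T) (hu : IsForwardSolution A ρ γ T f φ u)
    (hw : IsForwardSolution A ρ γ T f φ w) {μ : ℝ} (hμ : 0 < μ) (ℓ : H →L[ℝ] ℝ)
    (hℓ : ∀ x ∈ A.domain, ℓ (app A x) = μ * ℓ x) {t : ℝ} (ht : t ∈ Icc 0 T) :
    ℓ (u t) = ℓ (w t) := by
  have iu := integrableOn_deriv_of_caputoExists hρ.1 (hu.caputo_exists T (right_mem_Ioc.2 hT))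
  have iw := integrableOn_deriv_of_caputoExists hρ.1 (hw.caputo_exists T (right_mem_Ioc.2 hT))
  set h : ℝ → ℝ := fun ξ => ℓ (deriv u ξ) - ℓ (deriv w ξ) with hh
  set y : ℝ → ℝ := fun ξ => ℓ (u ξ) - ℓ (w ξ) with hy
  have ih : IntegrableOn h (Ioo 0 T) := (ℓ.integrable_comp iu).sub (ℓ.integrable_comp iw)
  have hyc : ContinuousOn y (Icc 0 T) :=
    (ℓ.continuous.comp_continuousOn hu.cont).sub (ℓ.continuous.comp_continuousOn hw.cont)
  have hyd : ∀ ξ ∈ Ioo 0 T, HasDerivAt y (h ξ) ξ := fun ξ hξ =>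
    (ℓ.hasFDerivAt.comp_hasDerivAt ξ (hu.hasDerivAt hξ).1).sub
      (ℓ.hasFDerivAt.comp_hasDerivAt ξ (hw.hasDerivAt hξ).1)
  have hy0 : y 0 = 0 := by simp [hy, hu.initial, hw.initial]
  have hint : ∀ t ∈ Icc 0 T, ∫ s in (0 : ℝ)..t, h s = y t := by
    intro t ht
    rw [intervalIntegral.integral_eq_sub_of_hasDerivAt_of_le ht.1
      (hyc.mono (Icc_subset_Icc_right ht.2))
      (fun ξ hξ => hyd ξ ⟨hξ.1, hξ.2.trans_le ht.2⟩)
      ((intervalIntegrable_iff_integrableOn_Ioo_of_le ht.1).2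
        (ih.mono_set (Ioo_subset_Ioo_right ht.2))), hy0, sub_zero]
  have heq : ∀ t ∈ Ioo 0 T, h t + causalConv (volterraKernel ρ γ μ) h t = 0 := by
    intro t ht
    have ht' := Ioo_subset_Ioc_self ht
    have one : ∀ u : ℝ → H, IsForwardSolution A ρ γ T f φ u →
        IntegrableOn (fun ξ => (t - ξ) ^ (-ρ) • ℓ (deriv u ξ)) (Ioo 0 t) ∧
        ℓ (deriv u t) + μ * ℓ (u t) + μ * γ * ((1 / Real.Gamma (1 - ρ)) *
          ∫ ξ in Ioo (0 : ℝ) t, (t - ξ) ^ (-ρ) • ℓ (deriv u ξ)) = ℓ (f t) := by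
      intro u hu
      have hc := (hu.caputo_exists t ht').2
      have e := hu.equation t ht'
      rw [(hu.hasDerivAt ht).2] at e
      have hs := app_smul hA (hu.caputo_mem_domain t ht') γ
      rw [app_add hA (hu.mem_domain t ht') hs.1, hs.2] at e
      have e' := congrArg ℓ e
      rw [map_add, map_add, map_smul, hℓ _ (hu.mem_domain t ht'),
        hℓ _ (hu.caputo_mem_domain t ht'), caputo, map_smul, ← ℓ.integral_comp_comm hc] at e'
      simp only [map_smul] at e'
      refine ⟨?_, ?_⟩
      · have := ℓ.integrable_comp hc
        simpa only [map_smul] using! this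
      · rw [← e']
        simp only [smul_eq_mul]
        ring
    obtain ⟨iu', eu⟩ := one u hu
    obtain ⟨iw', ew⟩ := one w hw
    have e3 : ∫ ξ in Ioo (0 : ℝ) t, (t - ξ) ^ (-ρ) • h ξ =
        (∫ ξ in Ioo (0 : ℝ) t, (t - ξ) ^ (-ρ) • ℓ (deriv u ξ)) -
        ∫ ξ in Ioo (0 : ℝ) t, (t - ξ) ^ (-ρ) • ℓ (deriv w ξ) := by
      rw [← integral_sub iu' iw']
      simp only [hh, smul_sub]
    have e4 : IntegrableOn (fun ξ => (t - ξ) ^ (-ρ) • h ξ) (Ioo 0 t) := by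
      simp only [hh, smul_sub]
      exact iu'.sub iw'
    rw [causalConv_volterraKernel ht.1.le (ih.mono_set (Ioo_subset_Ioo_right ht.2.le)) e4,
      hint t (Ioo_subset_Icc_self ht), e3]
    simp only [smul_eq_mul, hh, hy]
    linear_combination eu - ew
  have iK : IntegrableOn (volterraKernel ρ γ μ) (Ioo 0 T) := integrableOn_volterraKernel hρ hT
  -- The derivative `h` is only known to be integrable near 0, so its equation is convolved with 1
  -- to pass to the continuous function `y`.
  have hvol : ∀ t ∈ Icc 0 T, y t + causalConv (volterraKernel ρ γ μ) y t = 0 := by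
    intro t ht
    have e1 : causalConv (volterraKernel ρ γ μ) y t =
        causalConv (volterraKernel ρ γ μ) (causalConv h fun _ => (1 : ℝ)) t := by
      refine causalConv_congr (fun s hs => ?_) ht
      rw [causalConv_comm, causalConv_one, hint s hs]
    have e2 : y t = causalConv (fun _ => (1 : ℝ)) h t := by rw [causalConv_one, hint t ht]
    rw [e1, ← causalConv_assoc iK ih continuousOn_const ht, e2, causalConv_comm]
    have e3 : causalConv h (fun _ => (1 : ℝ)) t = causalConv (fun s =>
        -causalConv (volterraKernel ρ γ μ) h s) (fun _ => (1 : ℝ)) t := by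
      refine causalConv_congr_left ?_ ht
      filter_upwards [ae_restrict_mem measurableSet_Ioo] with s hs
      linarith [heq s hs]
    rw [e3]
    simp only [causalConv, neg_smul, intervalIntegral.integral_neg]
    ring
  have := eq_zero_of_volterra hρ hγ hμ hT hyc hvol t ht
  simpa [hy, sub_eq_zero] using this

theorem IsForwardSolution.unique (hA : IsEigenSystem A v lam) (hρ : ρ ∈ Ioo (0 : ℝ) 1)
    (hγ : 0 < γ) (hT : 0 < T) (hu : IsForwardSolution A ρ γ T f φ u)
    (hw : IsForwardSolution A ρ γ T f φ w) : EqOn u w (Icc 0 T) := by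
  intro t ht
  refine hilbertBasis_ext v fun k => RCLike.ext ?_ ?_
  · refine hu.functional_eq hA hρ hγ hT hw (hA.pos k)
      (RCLike.reCLM.comp ((innerSL 𝕜 (v k)).restrictScalars ℝ)) (fun x hx => ?_) ht
    simp [inner_app hA hx]
  · refine hu.functional_eq hA hρ hγ hT hw (hA.pos k)
      (RCLike.imCLM.comp ((innerSL 𝕜 (v k)).restrictScalars ℝ)) (fun x hx => ?_) ht
    simp [inner_app hA hx]

end Uniqueness

/-! ### Bounds on the multipliers, uniform in the eigenvalue. -/

section Multipliers

variable {ρ γ lam ε s : ℝ}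

/-- Interpolation: the quantity equals `(lam * B) ^ (1 - ε) * B ^ ε`, with `lam * B ≤ 1 / s` and `B
≤ 1`. -/
theorem abs_rpow_mul_kernelB_le (hρ : ρ ∈ Ioo (0 : ℝ) 1) (hγ : 0 < γ) (hl : 0 < lam)
    (hε : ε ∈ Ioo (0 : ℝ) 1) (hs : 0 < s) :
    |lam ^ (1 - ε) * kernelB ρ γ lam s| ≤ s ^ (ε - 1) := by
  have hB := kernelB_bounds hρ hγ hl hs.le
  have hA := (kernelA_bounds hρ hγ hl hs.le).2.2
  set B := kernelB ρ γ lam s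
  rw [abs_of_nonneg (mul_nonneg (Real.rpow_nonneg hl.le _) hB.1)]
  have h1 : B = B ^ (1 - ε) * B ^ ε := by
    rw [← Real.rpow_add_of_nonneg hB.1 (by linarith [hε.2]) hε.1.le, sub_add_cancel, Real.rpow_one]
  have h2 : lam * B ≤ s⁻¹ := by
    rw [inv_eq_one_div, le_div_iff₀ hs]
    linarith
  calc lam ^ (1 - ε) * B = (lam * B) ^ (1 - ε) * B ^ ε := by
        rw [Real.mul_rpow hl.le hB.1, mul_assoc, ← h1]
    _ ≤ (s⁻¹) ^ (1 - ε) * 1 := by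
        refine mul_le_mul (Real.rpow_le_rpow (mul_nonneg hl.le hB.1) h2 (by linarith [hε.2]))
          (Real.rpow_le_one hB.1 hB.2 hε.1.le) (Real.rpow_nonneg hB.1 _)
          (Real.rpow_nonneg (inv_nonneg.2 hs.le) _)
    _ = s ^ (ε - 1) := by
        rw [mul_one, Real.inv_rpow hs.le, ← Real.rpow_neg hs.le, neg_sub]

/-- Interpolation: the quantity equals `(D / lam) ^ ε * D ^ (1 - ε)`. Here `D ≤ 1 / s` alone just
fails to be integrable, and `D / lam ≤ c * s ^ (-ρ)` gains the exponent `ε * (1 - ρ)`. -/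
theorem abs_rpow_mul_kernelD_le (hρ : ρ ∈ Ioo (0 : ℝ) 1) (hγ : 0 < γ) (hl : 0 < lam)
    (hε : ε ∈ Ioo (0 : ℝ) 1) {T : ℝ} (hs : s ∈ Ioo 0 T)
    (hK : kernelD ρ γ lam s ≤ volterraKernel ρ γ lam s) :
    |lam ^ (-ε) * kernelD ρ γ lam s| ≤
      (T ^ ρ + γ * (1 / Real.Gamma (1 - ρ))) ^ ε * s ^ (ε * (1 - ρ) - 1) := by
  have hG := gamma_one_sub_pos hρ
  have hs0 := hs.1
  have hT : 0 < T := hs0.trans hs.2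
  have hD := kernelD_bounds hρ hγ hl hs0.le
  set D := kernelD ρ γ lam s
  set c := T ^ ρ + γ * (1 / Real.Gamma (1 - ρ)) with hc
  have hc0 : 0 < c := by positivity
  rw [abs_of_nonneg (mul_nonneg (Real.rpow_nonneg hl.le _) hD.1)]
  have h1 : D = D ^ ε * D ^ (1 - ε) := by
    rw [← Real.rpow_add_of_nonneg hD.1 hε.1.le (by linarith [hε.2]), add_sub_cancel, Real.rpow_one]
  have h2 : D ≤ s⁻¹ := by
    rw [inv_eq_one_div, le_div_iff₀ hs0]
    linarith [hD.2]
  have h3 : lam⁻¹ * D ≤ c * s ^ (-ρ) := by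
    -- This absorbs the constant term of the Volterra kernel into the singular one, which explains
    -- `T ^ ρ` in `c`.
    have h4 : (1 : ℝ) ≤ T ^ ρ * s ^ (-ρ) := by
      rw [Real.rpow_neg hs0.le, ← div_eq_mul_inv, one_le_div (Real.rpow_pos_of_pos hs0 _)]
      exact Real.rpow_le_rpow hs0.le hs.2.le hρ.1.le
    calc lam⁻¹ * D ≤ lam⁻¹ * volterraKernel ρ γ lam s :=
          mul_le_mul_of_nonneg_left hK (inv_nonneg.2 hl.le)
      _ = 1 + γ * ((1 / Real.Gamma (1 - ρ)) * s ^ (-ρ)) := by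
          unfold volterraKernel
          rw [inv_mul_cancel_left₀ hl.ne']
      _ ≤ c * s ^ (-ρ) := by rw [hc, add_mul]; linarith
  calc lam ^ (-ε) * D = (lam⁻¹ * D) ^ ε * D ^ (1 - ε) := by
        rw [Real.mul_rpow (inv_nonneg.2 hl.le) hD.1, mul_assoc, ← h1, Real.inv_rpow hl.le,
          Real.rpow_neg hl.le]
    _ ≤ (c * s ^ (-ρ)) ^ ε * (s⁻¹) ^ (1 - ε) := by
        refine mul_le_mul (Real.rpow_le_rpow (mul_nonneg (inv_nonneg.2 hl.le) hD.1) h3 hε.1.le)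
          (Real.rpow_le_rpow hD.1 h2 (by linarith [hε.2])) (Real.rpow_nonneg hD.1 _)
          (Real.rpow_nonneg (mul_nonneg hc0.le (Real.rpow_nonneg hs0.le _)) _)
    _ = _ := by
        rw [Real.mul_rpow hc0.le (Real.rpow_nonneg hs0.le _), Real.inv_rpow hs0.le,
          ← Real.rpow_neg hs0.le, ← Real.rpow_mul hs0.le, mul_assoc, ← Real.rpow_add hs0]
        congr 2
        ring

theorem integrableOn_rpow_sub_one {a T : ℝ} (ha : 0 < a) (hT : 0 < T) :
    IntegrableOn (fun s : ℝ => s ^ (a - 1)) (Ioo 0 T) :=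
  (intervalIntegral.integrableOn_Ioo_rpow_iff hT).2 (by linarith)

theorem causalConv_mul_smul {E : Type*} [NormedAddCommGroup E] [NormedSpace ℝ E] (c d : ℝ)
    (a : ℝ → ℝ) (h : ℝ → E) (t : ℝ) :
    causalConv (fun s => c * a s) (fun s => d • h s) t = (c * d) • causalConv a h t := by
  simp only [causalConv]
  rw [← intervalIntegral.integral_smul]
  congr 1 with s
  rw [smul_smul, smul_smul]
  congr 1
  ring

end Multipliers

/-! ### Continuity in the fractional norm. -/

section FracContinuous

variable {𝕜 : Type*} [RCLike 𝕜] {H : Type*} [NormedAddCommGroup H] [InnerProductSpace 𝕜 H]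
  {v : HilbertBasis ℕ 𝕜 H} {lam : ℕ → ℝ} {τ T : ℝ} {f : ℝ → H}

/-- `F` is `A^τ f`; continuity in the norm of the fractional domain is ordinary continuity of `F`.
-/
theorem ContinuousInFracDomain.exists_continuousOn (hlam : ∀ k, 0 < lam k)
    (hf : ContinuousInFracDomain v lam τ T f) :
    ∃ F : ℝ → H, ContinuousOn F (Icc 0 T) ∧ (∀ t ∈ Icc 0 T, fracNorm v lam τ (f t) = ‖F t‖) ∧
      ∀ t ∈ Icc 0 T, ∀ k, inner 𝕜 (v k) (F t) = lam k ^ τ • inner 𝕜 (v k) (f t) := by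
  have : ∀ t, ∃ y : H, t ∈ Icc 0 T → ∀ k, inner 𝕜 (v k) y = lam k ^ τ • inner 𝕜 (v k) (f t) := by
    intro t
    by_cases ht : t ∈ Icc 0 T
    · obtain ⟨y, hy⟩ := exists_fracPower hlam (hf.1 t ht)
      exact ⟨y, fun _ => hy⟩
    · exact ⟨0, fun h => absurd h ht⟩
  choose F hF using this
  refine ⟨F, fun t₀ ht₀ => ?_, fun t ht => fracNorm_eq_norm hlam (hF t ht), hF⟩
  rw [ContinuousWithinAt, tendsto_iff_norm_sub_tendsto_zero]
  refine (hf.2 t₀ ht₀).congr' ?_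
  filter_upwards [self_mem_nhdsWithin] with t ht
  refine fracNorm_eq_norm hlam fun k => ?_
  rw [inner_sub_right, inner_sub_right, hF t ht, hF t₀ ht₀, smul_sub]

/-- A real `⨆` over an unbounded family is 0 by default; compactness of `[0, T]` excludes this case.
-/
theorem ContinuousInFracDomain.fracNorm_sq_le (hlam : ∀ k, 0 < lam k)
    (hf : ContinuousInFracDomain v lam τ T f) {t : ℝ} (ht : t ∈ Icc 0 T) :
    fracNorm v lam τ (f t) ^ 2 ≤ ⨆ s : Icc (0 : ℝ) T, fracNorm v lam τ (f s) ^ 2 := by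
  obtain ⟨F, hFc, hFn, -⟩ := hf.exists_continuousOn hlam
  obtain ⟨M, hM⟩ := isCompact_Icc.exists_bound_of_continuousOn hFc
  refine le_ciSup (f := fun s : Icc (0 : ℝ) T => fracNorm v lam τ (f s) ^ 2) ⟨M ^ 2, ?_⟩ ⟨t, ht⟩
  rintro _ ⟨s, rfl⟩
  simp only
  rw [hFn s s.2]
  exact pow_le_pow_left₀ (norm_nonneg _) (hM s s.2) 2

end FracContinuous

theorem continuous_comp_projIcc {E : Type*} [TopologicalSpace E] {T : ℝ} (hT : 0 ≤ T) {g : ℝ → E}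
    (hg : ContinuousOn g (Icc 0 T)) : Continuous fun t => g (projIcc 0 T hT t) :=
  hg.comp_continuous (continuous_subtype_val.comp continuous_projIcc) fun t =>
    (projIcc 0 T hT t).2

theorem caputoExists_of_hasDerivAt {E : Type*} [NormedAddCommGroup E] [NormedSpace ℝ E] {u p : ℝ → E}
    {ρ : ℝ} (hρ : ρ < 1) (hp : Continuous p)
    (hu : ∀ t, HasDerivAt u (p t) t) {t : ℝ} (ht : 0 < t) : CaputoExists ρ u t := by
  refine ⟨fun ξ _ => (hu ξ).differentiableAt, ?_⟩
  have hd : deriv u = p := funext fun ξ => (hu ξ).deriv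
  rw [hd]
  have h1 : IntervalIntegrable (fun s : ℝ => s ^ (-ρ)) volume 0 t :=
    intervalIntegral.intervalIntegrable_rpow' (by linarith)
  have h2 := (h1.comp_sub_left t).symm
  simp only [sub_zero, sub_self] at h2
  have h3 := h2.smul_continuousOn (g := p) hp.continuousOn
  exact (intervalIntegrable_iff_integrableOn_Ioo_of_le ht.le).1 h3

/-! ### Construction of the solution and its bounds. -/

section Existence

variable {𝕜 : Type*} [RCLike 𝕜] {H : Type*} [NormedAddCommGroup H] [InnerProductSpace 𝕜 H]
  [CompleteSpace H] {A : H →ₗ.[𝕜] H} {v : HilbertBasis ℕ 𝕜 H} {lam : ℕ → ℝ}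
  {ρ γ T ε : ℝ} {f : ℝ → H} {φ : H}

variable [NormedSpace ℝ H]

/-- A pair `(p, q)` which, in the coordinates given by `v`, represents the derivative of a
solution and the image of that solution under `A`, yields a solution. -/
theorem isForwardSolution_of_coords (hA : IsEigenSystem A v lam) (hρ : ρ ∈ Ioo (0 : ℝ) 1)
    (hγ : 0 < γ) (hT : 0 < T) {f' p q : ℝ → H} (hf' : Continuous f')
    (hff : ∀ t ∈ Icc 0 T, f' t = f t)
    (hp : Continuous p) (hq : ContinuousOn q (Icc 0 T))
    (hpk : ∀ k, ∀ t ∈ Icc 0 T, inner 𝕜 (v k) (p t) =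
      (inner 𝕜 (v k) (f' t) - lam k • inner 𝕜 (v k) φ) -
      causalConv (kernelD ρ γ (lam k)) (fun s => inner 𝕜 (v k) (f' s) - lam k • inner 𝕜 (v k) φ) t)
    (hqk : ∀ k, ∀ t ∈ Icc 0 T, inner 𝕜 (v k) (q t) = lam k • (kernelA ρ γ (lam k) t •
      inner 𝕜 (v k) φ + causalConv (kernelB ρ γ (lam k)) (fun s => inner 𝕜 (v k) (f' s)) t)) :
    ∃ u : ℝ → H, IsForwardSolution A ρ γ T f φ u ∧
      (∀ k, ∀ t ∈ Icc 0 T, inner 𝕜 (v k) (u t) = kernelA ρ γ (lam k) t • inner 𝕜 (v k) φ +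
        causalConv (kernelB ρ γ (lam k)) (fun s => inner 𝕜 (v k) (f' s)) t) ∧
      ∀ t ∈ Ioc 0 T, derivWithin u (Icc 0 T) t = p t ∧ app A (u t) = q t ∧
        app A (caputo ρ u t) = γ⁻¹ • (f' t - p t - q t) := by
  -- Since `p` is continuous on the whole line, `u` is differentiable everywhere, including the
  -- endpoints.
  set u : ℝ → H := fun t => φ + ∫ s in (0 : ℝ)..t, p s with hu
  have hud : ∀ t, HasDerivAt u (p t) t := fun t =>
    (hp.integral_hasStrictDerivAt 0 t).hasDerivAt.const_add φ
  have hderiv : deriv u = p := funext fun t => (hud t).deriv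
  have hdW : ∀ t ∈ Icc 0 T, derivWithin u (Icc 0 T) t = p t := fun t ht =>
    (hud t).hasDerivWithinAt.derivWithin (uniqueDiffOn_Icc hT t ht)
  have hcont : ∀ (k : ℕ) (g : ℝ → H), Continuous g → Continuous fun s => inner 𝕜 (v k) (g s) :=
    fun k g hg => continuous_const.inner hg
  have hint : ∀ (k : ℕ) (t : ℝ), inner 𝕜 (v k) (∫ s in (0 : ℝ)..t, p s) =
      ∫ s in (0 : ℝ)..t, inner 𝕜 (v k) (p s) := fun k t => by
    have := (innerSL 𝕜 (v k)).intervalIntegral_comp_comm (hp.intervalIntegrable 0 t)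
      (μ := volume)
    simp only [innerSL_apply_apply] at this
    exact this.symm
  have hiD : ∀ k, IntegrableOn (kernelD ρ γ (lam k)) (Ioo 0 T) := fun k =>
    (integral_kernelD hρ hγ (hA.pos k) hT.le).1
  have hc : ∀ k, Continuous fun s => inner 𝕜 (v k) (f' s) - lam k • inner 𝕜 (v k) φ := fun k =>
    (hcont k f' hf').sub continuous_const
  have huk : ∀ k, ∀ t ∈ Icc 0 T, inner 𝕜 (v k) (u t) =
      kernelA ρ γ (lam k) t • inner 𝕜 (v k) φ +
        causalConv (kernelB ρ γ (lam k)) (fun s => inner 𝕜 (v k) (f' s)) t := by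
    intro k t ht
    have hiB : IntegrableOn (kernelB ρ γ (lam k)) (Ioo 0 T) := integrableOn_of_continuousOn_Icc
      ((continuousOn_kernelB hρ hγ (hA.pos k)).mono Icc_subset_Ici_self)
    have h1 := causalConv_of_resolvent (a := fun _ => 1) (integrableOn_const (by simp)) (hiD k)
      (hc k).continuousOn (hcont k p hp).continuousOn (hpk k) ht
    rw [causalConv_one] at h1
    -- Since `1 - 1 * D = B`, integrating `p = c - D * c` gives `B * c`; the constant part of `c`
    -- then turns into `kernelA - 1` because `lam (1 * B) = 1 - kernelA`.
    have h2 : causalConv (fun s => 1 - causalConv (fun _ => 1) (kernelD ρ γ (lam k)) s)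
        (fun s => inner 𝕜 (v k) (f' s) - lam k • inner 𝕜 (v k) φ) t =
        causalConv (kernelB ρ γ (lam k))
          (fun s => inner 𝕜 (v k) (f' s) - lam k • inner 𝕜 (v k) φ) t := by
      refine causalConv_congr_left ?_ ht
      filter_upwards [ae_restrict_mem measurableSet_Ioo] with s hs
      rw [causalConv_one, (integral_kernelD hρ hγ (hA.pos k) hs.1.le).2]
      ring
    have h3 : causalConv (kernelB ρ γ (lam k)) (fun _ => lam k • inner 𝕜 (v k) φ) t =
        (1 - kernelA ρ γ (lam k) t) • inner 𝕜 (v k) φ := by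
      rw [← integral_kernelB hρ hγ (hA.pos k) ht.1, causalConv, intervalIntegral.integral_smul_const,
        smul_smul, mul_comm]
    rw [h2, causalConv_sub hiB (hcont k f' hf').continuousOn continuousOn_const ht, h3] at h1
    rw [hu]
    simp only
    rw [inner_add_right, hint, h1, sub_smul, one_smul]
    abel
  have huA : ∀ t ∈ Icc 0 T, u t ∈ A.domain ∧ app A (u t) = q t := fun t ht =>
    app_eq_of_inner hA fun k => by rw [hqk k t ht, huk k t ht]
  have hcap : ∀ t ∈ Ioc 0 T, CaputoExists ρ u t := fun t ht =>
    caputoExists_of_hasDerivAt hρ.2 hp hud ht.1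
  have hcapA : ∀ t ∈ Ioc 0 T, caputo ρ u t ∈ A.domain ∧
      app A (caputo ρ u t) = γ⁻¹ • (f' t - p t - q t) := by
    intro t ht
    have ht' := Ioc_subset_Icc_self ht
    refine app_eq_of_inner hA fun k => ?_
    have hi := (hcap t ht).2
    -- By the resolvent identity `K * p = (K - K * D) * c = D * c = c - p`, which is the equation in
    -- the `k`-th coordinate.
    have h1 := causalConv_of_resolvent (integrableOn_volterraKernel (lam := lam k) (γ := γ) hρ hT)
      (hiD k) (hc k).continuousOn (hcont k p hp).continuousOn (hpk k) ht'
    rw [causalConv_congr_left (kernelD_resolvent_Ioo hρ hγ (hA.pos k)) ht'] at h1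
    have hi' : IntegrableOn (fun ξ => (t - ξ) ^ (-ρ) • inner 𝕜 (v k) (p ξ)) (Ioo 0 t) := by
      have := (innerSL 𝕜 (v k)).integrable_comp hi
      simpa only [hderiv, innerSL_apply_apply, inner_smul_right_eq_smul] using! this
    rw [causalConv_volterraKernel ht.1.le
      (integrableOn_of_continuousOn_Icc (hcont k p hp).continuousOn) hi', ← hint] at h1
    have h2 : inner 𝕜 (v k) (caputo ρ u t) = (1 / Real.Gamma (1 - ρ)) •
        ∫ ξ in Ioo (0 : ℝ) t, (t - ξ) ^ (-ρ) • inner 𝕜 (v k) (p ξ) := by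
      rw [caputo, inner_smul_right_eq_smul, ← innerSL_apply_apply 𝕜,
        ← (innerSL 𝕜 (v k)).integral_comp_comm hi]
      simp only [hderiv, innerSL_apply_apply, inner_smul_right_eq_smul]
    rw [← h2] at h1
    have h3 : inner 𝕜 (v k) (∫ s in (0 : ℝ)..t, p s) =
        inner 𝕜 (v k) (u t) - inner 𝕜 (v k) φ := by
      rw [hu, ← inner_sub_right, add_sub_cancel_left]
    rw [h3] at h1
    have h4 : inner 𝕜 (v k) (f' t) - inner 𝕜 (v k) (p t) - lam k • inner 𝕜 (v k) (u t) =
        (lam k * γ) • inner 𝕜 (v k) (caputo ρ u t) := by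
      have h5 := hpk k t ht'
      simp only [RCLike.real_smul_eq_coe_mul] at h1 h5 ⊢
      linear_combination (-1 : 𝕜) * h1 - h5
    rw [inner_smul_right_eq_smul, inner_sub_right, inner_sub_right, hqk k t ht', ← huk k t ht', h4,
      smul_smul]
    congr 1
    field_simp
  have hsol : IsForwardSolution A ρ γ T f φ u :=
    { cont := fun t _ => (hud t).continuousAt.continuousWithinAt
      diff := fun t _ => (hud t).differentiableAt.differentiableWithinAt
      cont_deriv := hp.continuousOn.congr fun t ht => hdW t (Ioc_subset_Icc_self ht)
      mem_domain := fun t ht => (huA t (Ioc_subset_Icc_self ht)).1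
      cont_app := (hq.mono Ioc_subset_Icc_self).congr fun t ht =>
        (huA t (Ioc_subset_Icc_self ht)).2
      caputo_exists := hcap
      caputo_mem_domain := fun t ht => (hcapA t ht).1
      cont_app_caputo := (continuousOn_const.smul ((hf'.continuousOn.sub hp.continuousOn).sub
        (hq.mono Ioc_subset_Icc_self))).congr fun t ht => (hcapA t ht).2
      equation := fun t ht => by
        have ht' := Ioc_subset_Icc_self ht
        have hs := app_smul hA (hcapA t ht).1 γ
        rw [hdW t ht', app_add hA (huA t ht').1 hs.1, hs.2, (huA t ht').2, (hcapA t ht).2,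
          smul_inv_smul₀ hγ.ne', hff t ht']
        abel
      initial := by simp [hu] }
  exact ⟨u, hsol, huk, fun t ht => ⟨hdW t (Ioc_subset_Icc_self ht),
    (huA t (Ioc_subset_Icc_self ht)).2, (hcapA t ht).2⟩⟩

/-- The bound for the contribution of the right-hand side to the derivative of the solution. -/
def derivBound (ρ γ T ε lam₀ : ℝ) : ℝ :=
  lam₀ ^ (-ε) + ∫ s in Ioo 0 T,
    (T ^ ρ + γ * (1 / Real.Gamma (1 - ρ))) ^ ε * s ^ (ε * (1 - ρ) - 1)

/-- The bound for the contribution of the right-hand side to `A u`. -/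
def appBound (T ε : ℝ) : ℝ := ∫ s in Ioo 0 T, s ^ (ε - 1)

theorem exists_solution (hA : IsEigenSystem A v lam) (hρ : ρ ∈ Ioo (0 : ℝ) 1)
    (hγ : 0 < γ) (hT : 0 < T) (hε : ε ∈ Ioo (0 : ℝ) 1) (hf : ContinuousInFracDomain v lam ε T f)
    (hφ : φ ∈ A.domain) {M : ℝ} (hM : ∀ t ∈ Icc 0 T, fracNorm v lam ε (f t) ≤ M) :
    ∃ u : ℝ → H, IsForwardSolution A ρ γ T f φ u ∧
      (∀ k, ∀ t ∈ Icc 0 T, inner 𝕜 (v k) (u t) = kernelA ρ γ (lam k) t • inner 𝕜 (v k) φ +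
        ∫ τ in (0 : ℝ)..t, kernelB ρ γ (lam k) (t - τ) • inner 𝕜 (v k) (f τ)) ∧
      ∀ t ∈ Ioc 0 T, ‖derivWithin u (Icc 0 T) t‖ ≤ ‖app A φ‖ + derivBound ρ γ T ε (lam 0) * M ∧
        ‖app A (u t)‖ ≤ ‖app A φ‖ + appBound T ε * M ∧
        ‖app A (caputo ρ u t)‖ ≤ γ⁻¹ * (lam 0 ^ (-ε) * M +
          (‖app A φ‖ + derivBound ρ γ T ε (lam 0) * M) + (‖app A φ‖ + appBound T ε * M)) := by
  obtain ⟨F, hFc, hFn, hFk⟩ := hf.exists_continuousOn hA.pos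
  -- Constant extension beyond `[0, T]` yields a globally continuous and bounded function, as the
  -- convolution lemmas require.
  set Φ : ℝ → H := fun t => F (projIcc 0 T hT.le t) with hΦ
  have hΦc : Continuous Φ := continuous_comp_projIcc hT.le hFc
  have hΦM : ∀ t, ‖Φ t‖ ≤ M := fun t => by
    simp only [hΦ]
    rw [← hFn _ (projIcc 0 T hT.le t).2]
    exact hM _ (projIcc 0 T hT.le t).2
  have hproj : ∀ t ∈ Icc 0 T, ((projIcc 0 T hT.le t : Icc (0 : ℝ) T) : ℝ) = t := fun t ht => by
    rw [projIcc_of_mem hT.le ht]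
  have hΦF : ∀ t ∈ Icc 0 T, Φ t = F t := fun t ht => by simp only [hΦ, hproj t ht]
  have hneg : ∀ k, |lam k ^ (-ε)| ≤ lam 0 ^ (-ε) := fun k => by
    rw [abs_of_nonneg (Real.rpow_nonneg (hA.pos k).le _)]
    exact Real.rpow_le_rpow_of_nonpos (hA.pos 0) (hA.mono (Nat.zero_le k)) (by linarith [hε.1])
  set f' : ℝ → H := fun t => diag v (fun k => lam k ^ (-ε)) (Φ t) with hf'
  have hf'c : Continuous f' := (continuous_diag v hneg).comp hΦc
  have hf'M : ∀ t, ‖f' t‖ ≤ lam 0 ^ (-ε) * M := fun t =>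
    (norm_diag_le v hneg _).trans
      (mul_le_mul_of_nonneg_left (hΦM t) (Real.rpow_nonneg (hA.pos 0).le _))
  have hpow : ∀ k, lam k ^ (-ε) * lam k ^ ε = 1 := fun k => by
    rw [← Real.rpow_add (hA.pos k), neg_add_cancel, Real.rpow_zero]
  have hΦk : ∀ k, (fun s => inner 𝕜 (v k) (Φ s)) = fun s => lam k ^ ε • inner 𝕜 (v k) (f' s) :=
    fun k => funext fun s => by
      rw [hf', inner_diag v hneg, smul_smul, mul_comm, hpow, one_smul]
  have hff : ∀ t ∈ Icc 0 T, f' t = f t := fun t ht => hilbertBasis_ext v fun k => by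
    rw [hf', inner_diag v hneg, hΦF t ht, hFk t ht, smul_smul, hpow, one_smul]
  set κP : ℝ → ℝ := fun s =>
    (T ^ ρ + γ * (1 / Real.Gamma (1 - ρ))) ^ ε * s ^ (ε * (1 - ρ) - 1) with hκP
  set κQ : ℝ → ℝ := fun s => s ^ (ε - 1) with hκQ
  have iP : IntegrableOn κP (Ioo 0 T) :=
    (integrableOn_rpow_sub_one (mul_pos hε.1 (by linarith [hρ.2])) hT).const_mul _
  have iQ : IntegrableOn κQ (Ioo 0 T) := integrableOn_rpow_sub_one hε.1 hT
  set mP : ℝ → ℕ → ℝ := fun s k => lam k ^ (-ε) * kernelD ρ γ (lam k) s with hmP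
  set mQ : ℝ → ℕ → ℝ := fun s k => lam k ^ (1 - ε) * kernelB ρ γ (lam k) s with hmQ
  have bP : ∀ᵐ s ∂volume.restrict (Ioo 0 T), ∀ k, |mP s k| ≤ κP s := by
    have : ∀ᵐ s ∂volume.restrict (Ioo 0 T), ∀ k,
        kernelD ρ γ (lam k) s ≤ volterraKernel ρ γ (lam k) s := ae_all_iff.2 fun k =>
      ae_restrict_of_ae_restrict_of_subset Ioo_subset_Ioi_self
        (kernelD_le_volterraKernel hρ hγ (hA.pos k))
    filter_upwards [this, ae_restrict_mem measurableSet_Ioo] with s hs hs' k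
    exact abs_rpow_mul_kernelD_le hρ hγ (hA.pos k) hε hs' (hs k)
  have bQ : ∀ᵐ s ∂volume.restrict (Ioo 0 T), ∀ k, |mQ s k| ≤ κQ s := by
    filter_upwards [ae_restrict_mem measurableSet_Ioo] with s hs k
    exact abs_rpow_mul_kernelB_le hρ hγ (hA.pos k) hε hs.1
  have sP : ∀ k, AEStronglyMeasurable (fun s => mP s k) (volume.restrict (Ioo 0 T)) := fun k =>
    (integral_kernelD hρ hγ (hA.pos k) hT.le).1.1.const_mul _
  have sQ : ∀ k, AEStronglyMeasurable (fun s => mQ s k) (volume.restrict (Ioo 0 T)) := fun k =>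
    (integrableOn_of_continuousOn_Icc ((continuousOn_kernelB hρ hγ (hA.pos k)).mono
      Icc_subset_Ici_self)).1.const_mul _
  have hBb : ∀ t ∈ Icc 0 T, ∀ k, |kernelB ρ γ (lam k) t| ≤ 1 := fun t ht k => by
    have := kernelB_bounds hρ hγ (hA.pos k) ht.1
    rw [abs_of_nonneg this.1]
    exact this.2
  have hAb : ∀ t ∈ Icc 0 T, ∀ k, |kernelA ρ γ (lam k) t| ≤ 1 := fun t ht k => by
    have := kernelA_bounds hρ hγ (hA.pos k) ht.1
    rw [abs_of_nonneg this.1]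
    exact this.2.1
  -- With `c = f - A φ`, the formula `c - D * c` becomes `f - B A φ - D * f`, since `1 - 1 * D = B`.
  -- The powers of `A` are redistributed so that `D * f = (A^(-ε) D) * Φ`, and likewise `A B * f =
  -- (A^(1-ε) B) * Φ` in `q`.
  set p : ℝ → H := fun t => f' t - diag v (fun k => kernelB ρ γ (lam k) t) (app A φ) -
    diagConv v mP Φ t with hp
  set q : ℝ → H := fun t => diag v (fun k => kernelA ρ γ (lam k) t) (app A φ) +
    diagConv v mQ Φ t with hq
  have hpc : ContinuousOn p (Icc 0 T) := by
    refine (hf'c.continuousOn.sub ?_).sub (continuousOn_diagConv iP bP sP hΦc hΦM)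
    exact continuousOn_diag v hBb (fun k => (continuousOn_kernelB hρ hγ (hA.pos k)).mono
      Icc_subset_Ici_self) _
  have hqc : ContinuousOn q (Icc 0 T) := by
    refine ContinuousOn.add ?_ (continuousOn_diagConv iQ bQ sQ hΦc hΦM)
    exact continuousOn_diag v hAb (fun k => (continuousOn_kernelA hρ hγ (hA.pos k)).mono
      Icc_subset_Ici_self) _
  have hpM : ∀ t ∈ Icc 0 T, ‖p t‖ ≤ ‖app A φ‖ + derivBound ρ γ T ε (lam 0) * M := by
    intro t ht
    have h1 := norm_diag_le v (hBb t ht) (app A φ)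
    have h2 := norm_diagConv_le (v := v) iP bP hΦM ht
    have h3 := hf'M t
    have h4 := norm_sub_le (f' t - diag v (fun k => kernelB ρ γ (lam k) t) (app A φ))
      (diagConv v mP Φ t)
    have h5 := norm_sub_le (f' t) (diag v (fun k => kernelB ρ γ (lam k) t) (app A φ))
    rw [derivBound, add_mul]
    linarith
  have hqM : ∀ t ∈ Icc 0 T, ‖q t‖ ≤ ‖app A φ‖ + appBound T ε * M := by
    intro t ht
    have h1 := norm_diag_le v (hAb t ht) (app A φ)
    have h2 := norm_diagConv_le (v := v) iQ bQ hΦM ht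
    have h4 := norm_add_le (diag v (fun k => kernelA ρ γ (lam k) t) (app A φ))
      (diagConv v mQ Φ t)
    rw [appBound]
    linarith
  have hf'k : ∀ k, ContinuousOn (fun s => inner 𝕜 (v k) (f' s)) (Icc 0 T) := fun k =>
    (continuous_const.inner hf'c).continuousOn
  obtain ⟨u, hu, huk, hub⟩ := isForwardSolution_of_coords hA hρ hγ hT (f' := f')
    (p := fun t => p (projIcc 0 T hT.le t)) (q := q) hf'c hff (continuous_comp_projIcc hT.le hpc)
    hqc (fun k t ht => by
      have hD := integral_kernelD hρ hγ (hA.pos k) hT.le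
      have h1 : causalConv (kernelD ρ γ (lam k)) (fun _ => lam k • inner 𝕜 (v k) φ) t =
          (1 - kernelB ρ γ (lam k) t) • lam k • inner 𝕜 (v k) φ := by
        rw [causalConv, intervalIntegral.integral_smul_const,
          (integral_kernelD hρ hγ (hA.pos k) ht.1).2]
      rw [hproj t ht, causalConv_sub hD.1 (hf'k k) continuousOn_const ht, h1, hp]
      simp only
      rw [inner_sub_right, inner_sub_right, inner_diag v (hBb t ht), inner_app hA hφ,
        inner_diagConv iP bP sP hΦc hΦM ht, hΦk, hmP]
      simp only
      rw [causalConv_mul_smul, hpow, one_smul, sub_smul, one_smul]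
      abel)
    (fun k t ht => by
      rw [hq]
      simp only
      rw [inner_add_right, inner_diag v (hAb t ht), inner_app hA hφ,
        inner_diagConv iQ bQ sQ hΦc hΦM ht, hΦk, hmQ]
      simp only
      rw [causalConv_mul_smul, ← Real.rpow_add (hA.pos k), sub_add_cancel, Real.rpow_one, smul_add,
        smul_comm])
  refine ⟨u, hu, fun k t ht => ?_, fun t ht => ?_⟩
  · rw [huk k t ht]
    congr 1
    have := intervalIntegral.integral_comp_sub_left (a := 0) (b := t)
      (fun τ => kernelB ρ γ (lam k) (t - τ) • inner 𝕜 (v k) (f τ)) t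
    simp only [sub_sub_cancel, sub_zero, sub_self] at this
    rw [← this]
    exact causalConv_congr (c := fun s => inner 𝕜 (v k) (f' s)) (d := fun s => inner 𝕜 (v k) (f s))
      (fun s hs => by rw [hff s hs]) ht
  · have ht' := Ioc_subset_Icc_self ht
    obtain ⟨h1, h2, h3⟩ := hub t ht
    rw [hproj t ht'] at h1 h3
    rw [h1, h2, h3]
    refine ⟨hpM t ht', hqM t ht', ?_⟩
    rw [norm_smul, Real.norm_of_nonneg (inv_nonneg.2 hγ.le)]
    refine mul_le_mul_of_nonneg_left ?_ (inv_nonneg.2 hγ.le)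
    have h4 := norm_sub_le (f' t - p t) (q t)
    have h5 := norm_sub_le (f' t) (p t)
    linarith [hpM t ht', hqM t ht', hf'M t]

end Existence

end RayleighStokes

end

theorem theorem3p1 {𝕜 : Type*} [RCLike 𝕜] {H : Type*} [NormedAddCommGroup H]
    [InnerProductSpace 𝕜 H] [NormedSpace ℝ H] [CompleteSpace H]
    (A : H →ₗ.[𝕜] H) (v : HilbertBasis ℕ 𝕜 H) (lam : ℕ → ℝ)
    (hA : RayleighStokes.IsEigenSystem A v lam)
    (ρ γ T : ℝ) (hρ : ρ ∈ Set.Ioo (0 : ℝ) 1) (hγ : 0 < γ) (hT : 0 < T) :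
    ∃ C : ℝ, 0 < C ∧ ∀ ε ∈ Set.Ioo (0 : ℝ) 1, ∃ Cε : ℝ, 0 < Cε ∧
      ∀ f : ℝ → H, RayleighStokes.ContinuousInFracDomain v lam ε T f →
      ∀ φ ∈ A.domain,
      ∃ u : ℝ → H,
        RayleighStokes.IsForwardSolution A ρ γ T f φ u ∧
        (∀ w : ℝ → H, RayleighStokes.IsForwardSolution A ρ γ T f φ w →
          Set.EqOn w u (Set.Icc 0 T)) ∧
        (∀ t ∈ Set.Icc 0 T,
          Summable (fun k : ℕ =>
            (RayleighStokes.kernelA ρ γ (lam k) t • inner 𝕜 (v k) φ) • v k) ∧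
          Summable (fun k : ℕ =>
            (∫ τ in (0 : ℝ)..t,
              RayleighStokes.kernelB ρ γ (lam k) (t - τ) • inner 𝕜 (v k) (f τ)) • v k) ∧
          u t =
            (∑' k : ℕ, (RayleighStokes.kernelA ρ γ (lam k) t • inner 𝕜 (v k) φ) • v k) +
            ∑' k : ℕ, (∫ τ in (0 : ℝ)..t,
              RayleighStokes.kernelB ρ γ (lam k) (t - τ) • inner 𝕜 (v k) (f τ)) • v k) ∧
        (∀ t ∈ Set.Ioc 0 T,
          ‖derivWithin u (Set.Icc 0 T) t‖ ^ 2 + ‖RayleighStokes.app A (u t)‖ ^ 2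
              + ‖RayleighStokes.app A (RayleighStokes.caputo ρ u t)‖ ^ 2
            ≤ C * t ^ (2 * (ρ - 1)) * ‖φ‖ ^ 2
              + C * RayleighStokes.fracNorm v lam 1 φ ^ 2
              + Cε * ⨆ s : Set.Icc (0 : ℝ) T,
                  RayleighStokes.fracNorm v lam ε (f s) ^ 2) := by
  have hpos : 0 < 4 + 8 * γ⁻¹ ^ 2 := by positivity
  -- The coefficient of `‖A φ‖ ^ 2` after `(y + z) ^ 2 ≤ 2 y ^ 2 + 2 z ^ 2`: 2 each from the
  -- derivative and `A u`, and `8 γ⁻¹ ^ 2` from the Caputo term, where `A φ` occurs twice.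
  refine ⟨4 + 8 * γ⁻¹ ^ 2, hpos, fun ε hε => ?_⟩
  have hlam0 := hA.pos 0
  set a := lam 0 ^ (-ε)
  set b := RayleighStokes.derivBound ρ γ T ε (lam 0)
  set c := RayleighStokes.appBound T ε
  -- The final `+ 1` only secures positivity.
  refine ⟨2 * b ^ 2 + 2 * c ^ 2 + 2 * γ⁻¹ ^ 2 * (a + b + c) ^ 2 + 1, by positivity,
    fun f hf φ hφ => ?_⟩
  set S := ⨆ s : Set.Icc (0 : ℝ) T, RayleighStokes.fracNorm v lam ε (f s) ^ 2
  have hS : ∀ t ∈ Set.Icc 0 T, RayleighStokes.fracNorm v lam ε (f t) ^ 2 ≤ S :=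
    fun t ht => hf.fracNorm_sq_le hA.pos ht
  have hS0 : 0 ≤ S := (sq_nonneg _).trans (hS 0 (Set.left_mem_Icc.2 hT.le))
  obtain ⟨u, hu, huk, hub⟩ := RayleighStokes.exists_solution hA hρ hγ hT hε hf hφ
    (M := Real.sqrt S) fun t ht => Real.le_sqrt_of_sq_le (hS t ht)
  refine ⟨u, hu, fun w hw => hw.unique hA hρ hγ hT hu, fun t ht => ?_, fun t ht => ?_⟩
  · have h1 := RayleighStokes.hasSum_diag v (m := fun k => RayleighStokes.kernelA ρ γ (lam k) t)
      (c := 1) (fun k => by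
        have := RayleighStokes.kernelA_bounds hρ hγ (hA.pos k) ht.1
        rw [abs_of_nonneg this.1]
        exact this.2.1) φ
    -- The second series converges as the difference between the basis expansion of `u t` and the
    -- first series.
    have h2 := (v.hasSum_repr (u t)).sub h1
    have h3 : ∀ k, v.repr (u t) k • v k -
        (RayleighStokes.kernelA ρ γ (lam k) t • inner 𝕜 (v k) φ) • v k =
        (∫ τ in (0 : ℝ)..t,
          RayleighStokes.kernelB ρ γ (lam k) (t - τ) • inner 𝕜 (v k) (f τ)) • v k := fun k => by
      rw [v.repr_apply_apply, huk k t ht, ← sub_smul, add_sub_cancel_left]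
    simp only [h3] at h2
    refine ⟨h1.summable, h2.summable, ?_⟩
    rw [h1.tsum_eq, h2.tsum_eq, add_sub_cancel]
  · obtain ⟨h1, h2, h3⟩ := hub t ht
    rw [RayleighStokes.fracNorm_one_eq hA hφ]
    have hM := Real.sq_sqrt hS0
    set M := Real.sqrt S
    set x := ‖RayleighStokes.app A φ‖
    have e1 := pow_le_pow_left₀ (norm_nonneg _) h1 2
    have e2 := pow_le_pow_left₀ (norm_nonneg _) h2 2
    have e3 := pow_le_pow_left₀ (norm_nonneg _) h3 2
    -- The singular term is merely added: the estimate already holds without it.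
    have e4 : 0 ≤ (4 + 8 * γ⁻¹ ^ 2) * t ^ (2 * (ρ - 1)) * ‖φ‖ ^ 2 := by
      have := Real.rpow_nonneg ht.1.le (2 * (ρ - 1))
      positivity
    have e5 : ∀ y z : ℝ, (y + z) ^ 2 ≤ 2 * y ^ 2 + 2 * z ^ 2 := fun y z => by
      linarith [sq_nonneg (y - z), sub_sq y z, add_sq y z]
    have e6 := e5 x (b * M)
    have e7 := e5 x (c * M)
    have e8 := mul_le_mul_of_nonneg_left (e5 (2 * x) ((a + b + c) * M)) (sq_nonneg γ⁻¹)
    have e9 : (γ⁻¹ * (a * M + (x + b * M) + (x + c * M))) ^ 2 =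
        γ⁻¹ ^ 2 * (2 * x + (a + b + c) * M) ^ 2 := by ring
    rw [← hM]
    have e10 := sq_nonneg M
    calc _ ≤ (2 * x ^ 2 + 2 * (b * M) ^ 2) + (2 * x ^ 2 + 2 * (c * M) ^ 2) +
          γ⁻¹ ^ 2 * (2 * (2 * x) ^ 2 + 2 * ((a + b + c) * M) ^ 2) := by linarith
      _ = (4 + 8 * γ⁻¹ ^ 2) * x ^ 2 +
          (2 * b ^ 2 + 2 * c ^ 2 + 2 * γ⁻¹ ^ 2 * (a + b + c) ^ 2) * M ^ 2 := by ring
      _ ≤ _ := by linarith
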